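/- For $d\ge 1$, a nonempty set $I\subseteq\{1,\dots,d\}$ and $0<\rho<1$, let $\mu_{I,\rho}$ be the distribution on $\{-1,1\}^d$ given by $$\mu_{I,\rho}(x)=2^{-d}\Bigl(1+\rho\prod_{i\in I}x_i\Bigr).$$ An $m$-party (broadcast) protocol is a randomized procedure in which, at each step, the bits broadcast so far and the randomness determine whether the protocol ends or which party speaks next; that party then broadcasts a bit which is a function of her own input, of the bits broadcast so far and of the randomness (which is independent of the inputs); when the protocol ends, its output is a function of the transcript and the randomness. Its communication complexity is the maximal total number of bits broadcast, over all inputs and over the randomness. For a family $\mathcal U$ of nonempty subsets of $\{1,\dots,d\}$, an $(m,n)$-protocol identifying $\mu\in\{\mu_{I,\rho}: I\in\mathcal U\}$ with error $\varepsilon$ is an $m$-party protocol in which the input of each party consists of $n$ samples and such that, for every $I\in\mathcal U$, if all $mn$ samples are drawn independently from $\mu_{I,\rho}$, then the protocol outputs $I$ with probability at least $1-\varepsilon$. **Theorem.** There is a numerical constant $C>0$ such that the following two statements hold. 1. Let $d\ge1$, let $\mathcal U$ be a family of nonempty subsets of $\{1,\dots,d\}$ with $|\mathcal U|\ge 2$,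 let $m,n\ge1$ be integers with $n\ge|\mathcal U|^6$, and let $0<\rho<1$ satisfy $\rho\le n^{-1/2}(\ln|\mathcal U|)^{-1/2}/C$. Then any $(m,n)$-protocol identifying $\mu\in\{\mu_{I,\rho}: I\in\mathcal U\}$ with error $1/3$ has communication complexity at least $$\frac{|\mathcal U|}{C\rho^2 n\,\ln\bigl(|\mathcal U|^2/(n\rho^2)\bigr)}.$$ 2. (Pairwise correlations.) Let $d\ge3$, let $m,n\ge1$ be integers with $n\ge\binom d2^6$, and let $0<\rho<1$ satisfy $\rho\le n^{-1/2}\bigl(\ln\binom d2\bigr)^{-1/2}/C$. Then any $(m,n)$-protocol identifying $\mu\in\{\mu_{I,\rho}: |I|=2\}$ with error $1/3$ has communication complexity at least $$\frac{d^2}{C\rho^2 n\,\ln\bigl(d/(n\rho^2)\bigr)},$$ that is, $\tilde\Omega\bigl(d^2/(n\rho^2)\bigr)$. -/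

import Mathlib

open MeasureTheory
open scoped ENNReal

/-- A randomized broadcast protocol for `m` parties.  Party `j` holds an input in `X`, visible only
to her; outputs lie in `ι`; the randomness of the protocol is a point of the probability space
`(R, coins)`.  The history is the list of all bits broadcast so far.  At each step, the history
(and the randomness) determines either that the protocol has ended (`none`) or which party speaks
next; that party then broadcasts one bit, which is a function of her input, the history and the
randomness (a longer message is a run of consecutive bits of the same speaker).  When the protocol
ends, the output is determined by the transcript and the randomness.

There is no bound on the number of rounds, and the order of speaking is adaptive.  All parties may
read the same random point, so private coins are the special case where `R` is a product over the
parties and each party only looks at her own component.  The last three fields are the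
measurability of the maps involved. -/
structure Protocol (m : ℕ) (X ι R : Type*) [MeasurableSpace X] [MeasurableSpace R] where
  /-- the law of the randomness -/
  coins : Measure R
  isProb : IsProbabilityMeasure coins
  /-- who speaks next, `none` if the protocol has ended -/
  speaker : R → List Bool → Option (Fin m)
  /-- the bit sent by the given party holding the given input after the given history -/
  message : R → Fin m → X → List Bool → Bool
  /-- the output when the protocol ends with the given transcript -/
  output : R → List Bool → ι
  measurable_speaker : ∀ h s, MeasurableSet {r | speaker r h = s}
  measurable_message : ∀ j h, Measurable fun p : R × X => message p.1 j p.2 h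
  measurable_output : ∀ h i, MeasurableSet {r | output r h = i}

namespace Protocol

variable {m : ℕ} {X ι R : Type*} [MeasurableSpace X] [MeasurableSpace R]

/-- The bits broadcast during the first `t` steps, when the randomness is `r` and party `j` holds
the input `x j`. -/
def history (π : Protocol m X ι R) (r : R) (x : Fin m → X) : ℕ → List Bool
  | 0 => []
  | t + 1 =>
    match π.speaker r (π.history r x t) with
    | none => π.history r x t
    | some j => π.history r x t ++ [π.message r j (x j) (π.history r x t)]

/-- The protocol ends, and its output is `i`. -/
def Outputs (π : Protocol m X ι R) (r : R) (x : Fin m → X) (i : ι) : Prop :=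
  ∃ t, π.speaker r (π.history r x t) = none ∧ π.output r (π.history r x t) = i

/-- The communication complexity: the maximal number of bits sent, over all inputs and over the
randomness of the protocol (`⊤` if this number is unbounded). -/
noncomputable def commComplexity (π : Protocol m X ι R) : ℕ∞ :=
  ⨆ (r : R) (x : Fin m → X) (t : ℕ), ((π.history r x t).length : ℕ∞)

end Protocol

/-- An `(m, n)`-protocol identifying the distribution among `(μ i)` with error `ε`: each of the `m`
parties holds `n` samples, and for every `i`, if all the `m * n` samples are drawn independently
from `μ i` (and independently of the randomness of the protocol), then the protocol outputs `i` with
probability at least `1 - ε`. -/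
def Protocol.Identifies {m n : ℕ} {Ω ι R : Type*} [MeasurableSpace Ω] [MeasurableSpace R]
    (π : Protocol m (Fin n → Ω) ι R) (μ : ι → Measure Ω) (ε : ℝ) : Prop :=
  ∀ i, 1 - ε ≤
    (π.coins.prod (Measure.pi fun _ : Fin m => Measure.pi fun _ : Fin n => μ i)).real
      {p | π.Outputs p.1 p.2 i}

/-- The distribution on `{-1, 1}^d` (written as `Fin d → ℤˣ`) which gives each point `x` the mass
`2^{-d} (1 + ρ ∏_{i ∈ I} x_i)`. -/
noncomputable def parityMeasure {d : ℕ} (ρ : ℝ) (I : Finset (Fin d)) : Measure (Fin d → ℤˣ) :=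
  ∑ x : Fin d → ℤˣ,
    ENNReal.ofReal ((2 ^ d)⁻¹ * (1 + ρ * ∏ i ∈ I, ((x i : ℤ) : ℝ))) • Measure.dirac x

/-! Fix the coins and compare each `μ_I` with the uniform distribution of all the samples. Under the
uniform distribution the events "the output is `I`" have total probability 1, so on average they are
rare. A successful protocol must therefore make the law of its transcript under `μ_I` far from the
uniform one for most `I`. Write `k` for the number of candidates, `N = ρ ^ 2 * n` and `B` for the
number of bits. The core of the proof is that the relative entropies of the transcript (uniform
against `μ_I`), summed over `I`, are `O(N * B)`. By `expect_mul_le_of_log` this gives `2k/3 ≤ 1 +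
k/12 + O(N * B)`, hence `k = O(N * B)`, and averaging over the coins keeps this. The logarithm in
the final denominator is at least 1 and only weakens the bound.

The fibers of the transcript are rectangles, so the likelihood ratio of a transcript is a product
over parties of averages `1 + z_I` of the one-party likelihood over a cell `A`. Since `z_I` has mean
zero, the relative entropy is the mean of `∑ j, (z_I - log (1 + z_I))`. It suffices to bound the sum
over `I` for one cell by `O(N) * log (|X| / |A|)` plus the average over `A` of an error `G` of mean
`O(N)` (`exists_sum_sub_log_le`). The logarithms add up to at most `B` on average, because there are
at most `2 ^ B` transcripts. The error is charged only to parties who speak, at most `B` of them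
(`sum_expect_neg_log_le`).

The bound for one cell is a level-one inequality. The likelihood is `exp (a * S_I + b)`, where `S_I`
is the sum of the signs `χ_I` over the sample and `a = O(ρ)`. Truncated at 2, it is an
`O(ρ)`-Lipschitz function of `S_I`. Distinct parities are uncorrelated, so a martingale argument
bounds the exponential moments of linear combinations of such functions (`expect_exp_sum_le`). The
Gibbs inequality turns this into a bound on how far conditioning on `A` moves their means in
quadratic mean (`sum_expect_deviation_sq_le`). The truncated part and the fourth moments from large
deviations form `G`. They are affordable because `k` is at most a small power of `n` and `N * log k`
is small. -/

/-! ### Rectangular partitions and the relative entropy of a transcript -/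

section Rectangles

set_option linter.unusedSectionVars false

open Finset
open scoped BigOperators

variable {ι X τ : Type*} [Fintype ι] [DecidableEq ι] [Fintype X] [DecidableEq X] [DecidableEq τ]

/-- The values of the coordinate `j` on the fiber of `T` over `h`. -/
def cell (T : (ι → X) → τ) (h : τ) (j : ι) : Finset X :=
  (univ.filter fun x => T x = h).image fun x => x j

/-- Every fiber of `T` is a combinatorial rectangle. -/
def IsRectangular (T : (ι → X) → τ) : Prop :=
  ∀ h x, (∀ j, x j ∈ cell T h j) → T x = h

variable {T : (ι → X) → τ}

lemma mem_cell_self (x : ι → X) (j : ι) : x j ∈ cell T (T x) j :=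
  mem_image_of_mem (fun x : ι → X => x j) (by simp)

lemma cell_nonempty (x : ι → X) (j : ι) : (cell T (T x) j).Nonempty := ⟨_, mem_cell_self x j⟩

lemma IsRectangular.fiber_eq (hT : IsRectangular T) (h : τ) :
    (univ.filter fun x => T x = h) = Fintype.piFinset (cell T h) := by
  ext x
  simp only [mem_filter, mem_univ, true_and, Fintype.mem_piFinset]
  exact ⟨fun hx j => hx ▸ mem_cell_self x j, hT h x⟩

lemma IsRectangular.sum_fiber_prod (hT : IsRectangular T) (h : τ) (f : ι → X → ℝ) :
    ∑ x with T x = h, ∏ j, f j (x j) = ∏ j, ∑ y ∈ cell T h j, f j y := by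
  rw [hT.fiber_eq, prod_univ_sum]

lemma sum_eq_sum_fibers (F : (ι → X) → ℝ) :
    ∑ x, F x = ∑ h ∈ univ.image T, ∑ x with T x = h, F x :=
  (sum_fiberwise_of_maps_to (fun x _ => mem_image_of_mem T (mem_univ x)) F).symm

lemma sum_piFinset_eval (A : ι → Finset X) (hA : ∀ j, (A j).Nonempty) (f : X → ℝ) (j : ι) :
    ∑ x ∈ Fintype.piFinset A, f (x j) = #(Fintype.piFinset A) * 𝔼 y ∈ A j, f y := by
  have h1 := prod_univ_sum A (fun i y => if i = j then f y else (1 : ℝ))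
  have h2 : ∀ x : ι → X, ∏ i, (if i = j then f (x i) else (1 : ℝ)) = f (x j) := fun x => by
    rw [prod_ite_eq' univ j (fun i => f (x i))]; simp
  simp_rw [h2] at h1
  rw [← h1, Fintype.card_piFinset, ← mul_prod_erase univ _ (mem_univ j), ←
    mul_prod_erase univ (fun i => #(A i)) (mem_univ j), expect_eq_sum_div_card]
  have h3 : (#(A j) : ℝ) ≠ 0 := by exact_mod_cast (hA j).card_pos.ne'
  have h4 : ∏ x ∈ univ.erase j, ∑ y ∈ A x, (if x = j then f y else (1 : ℝ)) =
      ∏ x ∈ univ.erase j, (#(A x) : ℝ) :=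
    prod_congr rfl fun i hi => by simp [(mem_erase.1 hi).1]
  rw [h4]
  simp only [if_true]
  rw [Nat.cast_mul, Nat.cast_prod, mul_right_comm, mul_div_cancel₀ _ h3, mul_comm]

/-- On a fiber, which is a rectangle, the coordinate `j` is uniform on its cell. Cell averages are
thus conditional expectations given `T`, and this is the tower property. -/
lemma IsRectangular.sum_mul_expect_cell (hT : IsRectangular T) (φ : τ → ℝ) (f : X → ℝ) (j : ι) :
    ∑ x, φ (T x) * 𝔼 y ∈ cell T (T x) j, f y = ∑ x, φ (T x) * f (x j) := by
  rw [sum_eq_sum_fibers (T := T), sum_eq_sum_fibers (T := T)]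
  refine sum_congr rfl fun h hh => ?_
  obtain ⟨x₀, -, rfl⟩ := mem_image.1 hh
  have h1 : ∀ F : τ → (ι → X) → ℝ, ∑ x with T x = T x₀, F (T x) x =
      ∑ x with T x = T x₀, F (T x₀) x := fun F =>
    sum_congr rfl fun x hx => by rw [(mem_filter.1 hx).2]
  rw [h1 fun h _ => φ h * 𝔼 y ∈ cell T h j, f y, h1 fun h x => φ h * f (x j), ← mul_sum,
    hT.fiber_eq, ← mul_sum, sum_piFinset_eval _ (cell_nonempty (T := T) x₀) f j,
    sum_const, nsmul_eq_mul]

/-- The ratio of the probabilities of `{T = h}` when the coordinates are independent with density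
`L`, respectively uniform. -/
noncomputable def cellRatio (T : (ι → X) → τ) (L : X → ℝ) (h : τ) : ℝ :=
  ∏ j, 𝔼 y ∈ cell T h j, L y

lemma IsRectangular.sum_mul_prod (hT : IsRectangular T) (φ : τ → ℝ) (L : X → ℝ) :
    ∑ x, φ (T x) * ∏ j, L (x j) = ∑ x, φ (T x) * cellRatio T L (T x) := by
  rw [sum_eq_sum_fibers (T := T), sum_eq_sum_fibers (T := T)]
  refine sum_congr rfl fun h hh => ?_
  obtain ⟨x₀, -, rfl⟩ := mem_image.1 hh
  have h1 : ∀ F : τ → (ι → X) → ℝ, ∑ x with T x = T x₀, F (T x) x =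
      ∑ x with T x = T x₀, F (T x₀) x := fun F =>
    sum_congr rfl fun x hx => by rw [(mem_filter.1 hx).2]
  rw [h1 fun h x => φ h * ∏ j, L (x j), h1 fun h _ => φ h * cellRatio T L h, ← mul_sum,
    hT.sum_fiber_prod _ fun _ => L, sum_const, nsmul_eq_mul, hT.fiber_eq, Fintype.card_piFinset,
    cellRatio]
  have : ∏ j, ∑ y ∈ cell T (T x₀) j, L y =
      (∏ j, (#(cell T (T x₀) j) : ℝ)) * ∏ j, 𝔼 y ∈ cell T (T x₀) j, L y := by
    rw [← prod_mul_distrib]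
    refine prod_congr rfl fun j _ => ?_
    have h3 : (#(cell T (T x₀) j) : ℝ) ≠ 0 := by exact_mod_cast (cell_nonempty (T := T) x₀ j).card_pos.ne'
    rw [expect_eq_sum_div_card]
    field_simp
  rw [this]
  push_cast
  ring

/-- Entropy bound: the expected total logarithmic loss of the cells is at most the logarithm of the
number of fibers. -/
lemma IsRectangular.expect_log_cell_le [Nonempty X] (hT : IsRectangular T) :
    𝔼 x : ι → X, ∑ j, Real.log (Fintype.card X / #(cell T (T x) j)) ≤
      Real.log #(univ.image T) := by
  set N : ℝ := ((#(univ.image T) : ℕ) : ℝ) with hN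
  have hNpos : 0 < N := by
    have : (univ.image T).Nonempty := univ_nonempty.image T
    exact Nat.cast_pos.2 this.card_pos
  set c : τ → ℝ := fun h => ∏ j, (Fintype.card X / #(cell T h j) : ℝ) with hc
  have hcX : (0 : ℝ) < Fintype.card X := by exact_mod_cast Fintype.card_pos
  have hpos : ∀ x j, (0 : ℝ) < Fintype.card X / #(cell T (T x) j) := fun x j =>
    div_pos hcX (by exact_mod_cast (cell_nonempty (T := T) x j).card_pos)
  have h1 : ∀ x : ι → X, ∑ j, Real.log (Fintype.card X / #(cell T (T x) j)) ≤
      c (T x) / N - 1 + Real.log N := fun x => by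
    rw [← Real.log_prod (fun j _ => (hpos x j).ne')]
    have h2 : 0 < c (T x) := prod_pos fun j _ => hpos x j
    have := Real.log_le_sub_one_of_pos (div_pos h2 hNpos)
    rw [Real.log_div h2.ne' hNpos.ne'] at this
    simp only [hc] at this ⊢
    linarith
  refine (expect_le_expect fun x _ => h1 x).trans ?_
  -- On each fiber `c` is the inverse of its uniform probability, so every fiber contributes the
  -- same amount.
  have h3 : ∑ x, c (T x) = (Fintype.card (ι → X) : ℝ) * N := by
    rw [sum_eq_sum_fibers (T := T), hN, ← nsmul_eq_mul', ← sum_const]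
    refine sum_congr rfl fun h hh => ?_
    obtain ⟨x₀, -, rfl⟩ := mem_image.1 hh
    rw [sum_congr rfl fun x hx => by rw [(mem_filter.1 hx).2], sum_const, hT.fiber_eq,
      Fintype.card_piFinset, nsmul_eq_mul, hc]
    push_cast
    rw [← prod_mul_distrib, Fintype.card_fun, prod_congr rfl fun j _ => mul_div_cancel₀ _ ?_]
    · simp
    · exact_mod_cast (cell_nonempty (T := T) x₀ j).card_pos.ne'
  have h4 : (Fintype.card (ι → X) : ℝ) ≠ 0 := by exact_mod_cast Fintype.card_ne_zero
  rw [expect_add_distrib, expect_sub_distrib, ← expect_div, Fintype.expect_eq_sum_div_card, h3]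
  simp only [Fintype.expect_const]
  field_simp
  linarith

lemma IsRectangular.cell_update_eq_univ (hT : IsRectangular T) (x : ι → X) (j : ι) (y : X)
    (h : cell T (T x) j = univ) : T (Function.update x j y) = T x := by
  refine hT _ _ fun i => ?_
  by_cases hi : i = j
  · subst hi; simp [h]
  · rw [Function.update_of_ne hi]; exact mem_cell_self x i

lemma cell_eq_univ_of_update (x : ι → X) (j : ι) (h : ∀ y, T (Function.update x j y) = T x) :
    cell T (T x) j = univ := by
  refine eq_univ_iff_forall.2 fun y => ?_
  rw [← h y]
  simpa using mem_cell_self (T := T) (Function.update x j y) j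

lemma IsRectangular.cell_update_eq_univ_iff (hT : IsRectangular T) (x : ι → X) (j : ι) (y : X) :
    cell T (T (Function.update x j y)) j = univ ↔ cell T (T x) j = univ := by
  constructor
  · intro h
    have h1 := hT.cell_update_eq_univ _ j (x j) h
    rw [Function.update_idem, Function.update_eq_self] at h1
    rw [h1]; exact h
  · intro h
    rw [hT.cell_update_eq_univ x j y h]; exact h

/-- A function of `x` not depending on the coordinate `j` is uncorrelated with functions of
`x j`. -/
lemma sum_mul_eval_of_update (V : (ι → X) → ℝ) (j : ι)
    (hV : ∀ x y, V (Function.update x j y) = V x) (f : X → ℝ) :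
    ∑ x, V x * f (x j) = (∑ x, V x) * 𝔼 y, f y := by
  rcases isEmpty_or_nonempty X with hX | hX
  · have : IsEmpty (ι → X) := ⟨fun x => hX.elim (x j)⟩
    simp
  have h1 : ∀ y : X, ∑ x, V x * f (x j) = ∑ x : ι → X, ∑ y, V x * f y / Fintype.card X := by
    intro _
    have h2 : ∑ x : ι → X, ∑ y, V x * f y / Fintype.card X =
        ∑ p : (ι → X) × X, V p.1 * f p.2 / Fintype.card X := by
      rw [Fintype.sum_prod_type]
    -- Exchanging `x j` with an independent copy `y` preserves the uniform distribution of the pair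
    -- and leaves `V` unchanged.
    let e : ((ι → X) × X) ≃ ((ι → X) × X) :=
      { toFun := fun p => (Function.update p.1 j p.2, p.1 j)
        invFun := fun p => (Function.update p.1 j p.2, p.1 j)
        left_inv := fun p => by simp
        right_inv := fun p => by simp }
    rw [h2, ← e.sum_comp, Fintype.sum_prod_type]
    refine sum_congr rfl fun x _ => ?_
    simp only [e, Equiv.coe_fn_mk, hV]
    rw [sum_const, card_univ, nsmul_eq_mul]
    have : (Fintype.card X : ℝ) ≠ 0 := by exact_mod_cast Fintype.card_ne_zero
    field_simp
  rw [h1 (Classical.arbitrary X), Fintype.expect_eq_sum_div_card, sum_mul]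
  refine sum_congr rfl fun x _ => ?_
  rw [mul_div_assoc', mul_sum, sum_div]

/-- Change of measure: the probability of an event grows by at most a multiple of the relative
entropy plus a small constant. -/
lemma expect_mul_le_of_log {Y : Type*} [Fintype Y] [Nonempty Y] (q φ : Y → ℝ)
    (hq : ∀ y, 0 < q y) (hq1 : 𝔼 y, q y = 1) (hφ0 : ∀ y, 0 ≤ φ y) (hφ1 : ∀ y, φ y ≤ 1) :
    𝔼 y, φ y * q y ≤ 𝔼 y, φ y + 12 * 𝔼 y, -Real.log (q y) + 1 / 12 := by
  -- A Hellinger-type estimate with `s = √q`: AM-GM splits `|q - 1| = |s - 1| * (s + 1)`, and `(s -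
  -- 1) ^ 2 ≤ q - 1 - log q`. The last summand has mean `1 / 12`.
  have h1 : ∀ y, φ y * q y ≤ φ y + 12 * (q y - 1 + -Real.log (q y)) + (q y + 1) / 24 := fun y => by
    set s := Real.sqrt (q y) with hs
    have hs0 : 0 < s := Real.sqrt_pos.2 (hq y)
    have hsq : q y = s ^ 2 := (Real.sq_sqrt (hq y).le).symm
    have hlog : Real.log (q y) ≤ 2 * (s - 1) := by
      rw [hsq, Real.log_pow]
      have := Real.log_le_sub_one_of_pos hs0
      push_cast
      linarith
    have h2 : φ y * (q y - 1) ≤ |q y - 1| :=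
      (mul_le_mul_of_nonneg_left (le_abs_self _) (hφ0 y)).trans
        (mul_le_of_le_one_left (abs_nonneg _) (hφ1 y))
    have h3 : |q y - 1| ≤ 12 * (s - 1) ^ 2 + (s + 1) ^ 2 / 48 := by
      rw [hsq, abs_le]
      constructor <;> nlinarith [sq_nonneg (24 * (s - 1) - (s + 1)),
        sq_nonneg (24 * (s - 1) + (s + 1))]
    nlinarith [sq_nonneg (s - 1)]
  refine (expect_le_expect fun y _ => h1 y).trans (le_of_eq ?_)
  rw [expect_add_distrib, expect_add_distrib, ← mul_expect, expect_add_distrib,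
    expect_sub_distrib, ← expect_div, expect_add_distrib, hq1]
  simp only [Fintype.expect_const]
  ring

/-- If a density changes the probabilities of all cells little, then it changes the law of `T`
little.  The error `G` is only charged for the coordinates on which `T` depends. -/
lemma IsRectangular.sum_expect_neg_log_le {κ : Type*} [Fintype κ] [Nonempty X]
    (hT : IsRectangular T) (L : κ → X → ℝ) (hL : ∀ I y, 0 < L I y) (hL1 : ∀ I, 𝔼 y, L I y = 1)
    {α β : ℝ} (hα : 0 ≤ α) (G : X → ℝ) (hG : 𝔼 y, G y ≤ β) (hβ : 0 ≤ β)
    (hone : ∀ A : Finset X, A.Nonempty →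
      ∑ I, ((𝔼 y ∈ A, L I y) - 1 - Real.log (𝔼 y ∈ A, L I y)) ≤
        α * Real.log (Fintype.card X / #A) + 𝔼 y ∈ A, G y)
    {B : ℕ} (hB : ∀ x, #(univ.filter fun j => cell T (T x) j ≠ univ) ≤ B) :
    ∑ I, 𝔼 x, -Real.log (cellRatio T (L I) (T x)) ≤ α * Real.log #(univ.image T) + β * B := by
  have hcX : (0 : ℝ) < Fintype.card (ι → X) := by exact_mod_cast Fintype.card_pos
  have hpos : ∀ I x j, 0 < 𝔼 y ∈ cell T (T x) j, L I y := fun I x j =>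
    expect_pos (fun y _ => hL I y) (cell_nonempty x j)
  -- This allows replacing `-log (1 + z)` by the nonnegative `z - log (1 + z)`, which is quadratic
  -- for small `z`.
  have hmean : ∀ I j, 𝔼 x, ((𝔼 y ∈ cell T (T x) j, L I y) - 1) = 0 := fun I j => by
    have h1 := hT.sum_mul_expect_cell (fun _ => 1) (L I) j
    have h2 := sum_mul_eval_of_update (fun _ : ι → X => (1 : ℝ)) j (fun _ _ => rfl) (L I)
    simp only [one_mul] at h1 h2
    rw [expect_sub_distrib, Fintype.expect_eq_sum_div_card, h1, h2, hL1]
    simp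
  have e1 : ∑ I, 𝔼 x, -Real.log (cellRatio T (L I) (T x)) =
      𝔼 x, ∑ j, ∑ I, ((𝔼 y ∈ cell T (T x) j, L I y) - 1 -
        Real.log (𝔼 y ∈ cell T (T x) j, L I y)) := by
    rw [← expect_sum_comm]
    simp_rw [sum_comm (s := univ (α := ι))]
    rw [expect_sum_comm, expect_sum_comm]
    refine sum_congr rfl fun I _ => ?_
    have : ∀ x, -Real.log (cellRatio T (L I) (T x)) =
        ∑ j, -Real.log (𝔼 y ∈ cell T (T x) j, L I y) := fun x => by
      rw [cellRatio, Real.log_prod (fun j _ => (hpos I x j).ne'), sum_neg_distrib]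
    simp_rw [this, sub_eq_add_neg _ (Real.log _), sum_add_distrib]
    rw [expect_add_distrib, expect_sum_comm (f := fun x j => (𝔼 y ∈ cell T (T x) j, L I y) - 1),
      sum_eq_zero fun j _ => hmean I j, zero_add]
  set v : τ → ι → ℝ := fun h j => if cell T h j = univ then 0 else 1 with hv
  have e2 : ∀ x, ∑ j, ∑ I, ((𝔼 y ∈ cell T (T x) j, L I y) - 1 -
        Real.log (𝔼 y ∈ cell T (T x) j, L I y)) ≤
      α * ∑ j, Real.log (Fintype.card X / #(cell T (T x) j)) +
        ∑ j, v (T x) j * 𝔼 y ∈ cell T (T x) j, G y := fun x => by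
    rw [mul_sum, ← sum_add_distrib]
    refine sum_le_sum fun j _ => ?_
    by_cases h : cell T (T x) j = univ
    · have : (Fintype.card X : ℝ) ≠ 0 := by exact_mod_cast Fintype.card_ne_zero
      simp [hv, h, hL1, this]
    · simpa [hv, h] using hone _ (cell_nonempty x j)
  rw [e1]
  refine (expect_le_expect fun x _ => e2 x).trans ?_
  rw [expect_add_distrib, ← mul_expect]
  refine add_le_add (mul_le_mul_of_nonneg_left hT.expect_log_cell_le hα) ?_
  rw [Fintype.expect_eq_sum_div_card, div_le_iff₀ hcX, sum_comm]
  -- Whether the cell is everything does not depend on `x j`, so the indicator `v` is independent of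
  -- `G (x j)` and only the mean of `G` enters.
  have e3 : ∀ j, ∑ x, v (T x) j * 𝔼 y ∈ cell T (T x) j, G y ≤ ∑ x, v (T x) j * β := fun j => by
    rw [hT.sum_mul_expect_cell (fun h => v h j), sum_mul_eval_of_update (fun x => v (T x) j) j
      (fun x y => by simp only [hv, hT.cell_update_eq_univ_iff]), ← sum_mul]
    refine mul_le_mul_of_nonneg_left hG (sum_nonneg fun x _ => ?_)
    simp only [hv]; split_ifs <;> norm_num
  refine (sum_le_sum fun j _ => e3 j).trans ?_
  rw [sum_comm, mul_comm (β * B), ← nsmul_eq_mul, ← card_univ, ← sum_const]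
  refine sum_le_sum fun x _ => ?_
  rw [← sum_mul, mul_comm]
  refine mul_le_mul_of_nonneg_left ?_ hβ
  have : ∑ j, v (T x) j = #(univ.filter fun j => cell T (T x) j ≠ univ) := by
    rw [card_filter]; push_cast
    refine sum_congr rfl fun j _ => ?_
    by_cases h : cell T (T x) j = univ <;> simp [hv, h]
  rw [this]
  exact_mod_cast hB x

end Rectangles

/-! ### Exponential moments and the level-one inequality -/

section LevelOne

set_option linter.unusedSectionVars false

open Finset
open scoped BigOperators

variable {κ Ω : Type*} [Fintype κ] [Fintype Ω]

/-- Centred, pairwise uncorrelated signs on a finite set with the uniform distribution. -/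
structure IsUncorrelatedSigns (χ : κ → Ω → ℝ) : Prop where
  sign : ∀ I y, χ I y = 1 ∨ χ I y = -1
  mean : ∀ I, 𝔼 y, χ I y = 0
  orth : ∀ I J, I ≠ J → 𝔼 y, χ I y * χ J y = 0

/-- The sum of a function over the entries of a sample. -/
def sampleSum {n : ℕ} (f : Ω → ℝ) (x : Fin n → Ω) : ℝ := ∑ t, f (x t)

variable {χ : κ → Ω → ℝ}

lemma IsUncorrelatedSigns.expect_sum (hχ : IsUncorrelatedSigns χ) (d : κ → ℝ) :
    𝔼 y, ∑ I, d I * χ I y = 0 := by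
  rw [expect_sum_comm]
  exact sum_eq_zero fun I _ => by rw [← mul_expect, hχ.mean, mul_zero]

lemma IsUncorrelatedSigns.expect_sum_sq [Nonempty Ω] (hχ : IsUncorrelatedSigns χ) (d : κ → ℝ) :
    𝔼 y, (∑ I, d I * χ I y) ^ 2 = ∑ I, d I ^ 2 := by
  classical
  have h1 : ∀ y, (∑ I, d I * χ I y) ^ 2 = ∑ I, ∑ J, d I * d J * (χ I y * χ J y) := fun y => by
    rw [sq, sum_mul_sum]
    exact sum_congr rfl fun I _ => sum_congr rfl fun J _ => by ring
  simp_rw [h1]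
  rw [expect_sum_comm]
  refine sum_congr rfl fun I _ => ?_
  rw [expect_sum_comm, sum_eq_single I]
  · rw [← mul_expect]
    have : ∀ y, χ I y * χ I y = 1 := fun y => by
      rcases hχ.sign I y with h | h <;> rw [h] <;> norm_num
    simp_rw [this]
    rw [Fintype.expect_const]; ring
  · intro J _ hJ
    rw [← mul_expect, hχ.orth I J hJ.symm, mul_zero]
  · simp

/-- Since the exponent stays in `[-1, 1]`, `exp u ≤ 1 + u + u ^ 2` reduces the claim to two moments,
for which pairwise uncorrelatedness suffices. -/
lemma IsUncorrelatedSigns.expect_exp_le [Nonempty Ω] (hχ : IsUncorrelatedSigns χ) (d : κ → ℝ)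
    (hd : ∑ I, |d I| ≤ 1) : 𝔼 y, Real.exp (∑ I, d I * χ I y) ≤ Real.exp (∑ I, d I ^ 2) := by
  have h1 : ∀ y, Real.exp (∑ I, d I * χ I y) ≤
      1 + (∑ I, d I * χ I y) + (∑ I, d I * χ I y) ^ 2 := fun y => by
    have h2 : |∑ I, d I * χ I y| ≤ 1 := by
      refine (abs_sum_le_sum_abs _ _).trans (le_trans (sum_le_sum fun I _ => ?_) hd)
      rcases hχ.sign I y with h | h <;> simp [h]
    have := (abs_le.1 (Real.abs_exp_sub_one_sub_id_le h2)).2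
    linarith
  refine (expect_le_expect fun y _ => h1 y).trans ?_
  rw [expect_add_distrib, expect_add_distrib, hχ.expect_sum, hχ.expect_sum_sq,
    Fintype.expect_const]
  linarith [Real.add_one_le_exp (∑ I, d I ^ 2)]

lemma expect_fin_succ {n : ℕ} (F : (Fin (n + 1) → Ω) → ℝ) :
    𝔼 x, F x = 𝔼 y, 𝔼 x : Fin n → Ω, F (Fin.cons y x) := by
  rw [← Fintype.expect_equiv (Fin.consEquiv fun _ => Ω) (fun p => F (Fin.cons p.1 p.2)) F
    (fun p => rfl), ← univ_product_univ, expect_product]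

lemma sampleSum_cons {n : ℕ} (f : Ω → ℝ) (y : Ω) (x : Fin n → Ω) :
    sampleSum f (Fin.cons y x : Fin (n + 1) → Ω) = f y + sampleSum f x := by
  simp [sampleSum, Fin.sum_univ_succ]

/-- A Doob martingale argument, revealing one sample at a time. Given the first sample `y`, the
conditional mean of the `I`-th function depends only on the sign `χ I y`, so it is affine in it with
slope at most `w I`. The increments are thus combinations of the `χ I`, to which `expect_exp_le`
applies. -/
lemma IsUncorrelatedSigns.expect_exp_sum_le [Nonempty Ω] (hχ : IsUncorrelatedSigns χ) (w : κ → ℝ)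
    (hw : ∑ I, w I ≤ 1) (n : ℕ) : ∀ (g : κ → ℝ → ℝ),
    (∀ I s, |g I (s + 1) - g I (s - 1)| ≤ 2 * w I) →
    𝔼 x : Fin n → Ω, Real.exp (∑ I, (g I (sampleSum (χ I) x) -
      𝔼 x' : Fin n → Ω, g I (sampleSum (χ I) x'))) ≤ Real.exp (n * ∑ I, w I ^ 2) := by
  induction n with
  | zero =>
    intro g _
    simp [sampleSum]
  | succ n ih =>
    intro g hg
    set h : κ → ℝ → ℝ := fun I s => 𝔼 x : Fin n → Ω, g I (s + sampleSum (χ I) x) with hh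
    set d : κ → ℝ := fun I => (h I 1 - h I (-1)) / 2 with hd
    have hdw : ∀ I, |d I| ≤ w I := fun I => by
      have h1 : h I 1 - h I (-1) = 𝔼 x : Fin n → Ω,
          (g I (1 + sampleSum (χ I) x) - g I (-1 + sampleSum (χ I) x)) := by
        rw [expect_sub_distrib]
      have h2 : |h I 1 - h I (-1)| ≤ 2 * w I := by
        rw [h1]
        refine (abs_expect_le _ _).trans (expect_le univ_nonempty fun x _ => ?_)
        have := hg I (sampleSum (χ I) x)
        rwa [add_comm 1, show (-1 : ℝ) + sampleSum (χ I) x = sampleSum (χ I) x - 1 by ring]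
      rw [hd, abs_div, abs_of_pos (by norm_num : (0 : ℝ) < 2)]
      linarith
    have hw0 : ∀ I, 0 ≤ w I := fun I => (abs_nonneg _).trans (hdw I)
    have hmid : ∀ I y, h I (χ I y) = (h I 1 + h I (-1)) / 2 + d I * χ I y := fun I y => by
      rcases hχ.sign I y with e | e <;> rw [e] <;> simp only [hd] <;> ring
    have hmean : ∀ I, 𝔼 x' : Fin (n + 1) → Ω, g I (sampleSum (χ I) x') =
        (h I 1 + h I (-1)) / 2 := fun I => by
      rw [expect_fin_succ]
      simp_rw [sampleSum_cons]
      have : ∀ y, (𝔼 x : Fin n → Ω, g I (χ I y + sampleSum (χ I) x)) = h I (χ I y) := fun y => rfl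
      simp_rw [this, hmid]
      rw [expect_add_distrib, ← mul_expect, hχ.mean, Fintype.expect_const]; ring
    rw [expect_fin_succ]
    have hstep : ∀ y, 𝔼 x : Fin n → Ω, Real.exp (∑ I, (g I (sampleSum (χ I)
        (Fin.cons y x : Fin (n + 1) → Ω)) - 𝔼 x' : Fin (n + 1) → Ω, g I (sampleSum (χ I) x'))) ≤
        Real.exp (∑ I, d I * χ I y) * Real.exp (n * ∑ I, w I ^ 2) := fun y => by
      have e1 : ∀ x : Fin n → Ω, Real.exp (∑ I, (g I (sampleSum (χ I)
          (Fin.cons y x : Fin (n + 1) → Ω)) - 𝔼 x' : Fin (n + 1) → Ω, g I (sampleSum (χ I) x'))) =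
          Real.exp (∑ I, d I * χ I y) * Real.exp (∑ I, (g I (χ I y + sampleSum (χ I) x) -
            𝔼 x' : Fin n → Ω, g I (χ I y + sampleSum (χ I) x'))) := fun x => by
        rw [← Real.exp_add, ← sum_add_distrib]
        congr 1
        refine sum_congr rfl fun I _ => ?_
        have : (𝔼 x : Fin n → Ω, g I (χ I y + sampleSum (χ I) x)) = h I (χ I y) := rfl
        rw [this, hmean, sampleSum_cons, hmid]; ring
      simp_rw [e1]
      rw [← mul_expect]
      refine mul_le_mul_of_nonneg_left (ih (fun I s => g I (χ I y + s)) fun I s => ?_)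
        (Real.exp_pos _).le
      have := hg I (χ I y + s)
      rwa [add_assoc, add_sub_assoc] at this
    refine (expect_le_expect fun y _ => hstep y).trans ?_
    rw [← expect_mul]
    refine (mul_le_mul_of_nonneg_right (hχ.expect_exp_le d
      ((sum_le_sum fun I _ => hdw I).trans hw)) (Real.exp_pos _).le).trans ?_
    rw [← Real.exp_add, Real.exp_le_exp]
    have : ∑ I, d I ^ 2 ≤ ∑ I, w I ^ 2 := sum_le_sum fun I _ => by
      rw [← sq_abs]; exact pow_le_pow_left₀ (abs_nonneg _) (hdw I) 2
    push_cast
    linarith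

/-- The Gibbs variational inequality for the uniform distribution on `A`. -/
lemma expect_le_log_add {X : Type*} [Fintype X] (A : Finset X) (hA : A.Nonempty) (F : X → ℝ)
    {c : ℝ} (hF : 𝔼 x, Real.exp (F x) ≤ Real.exp c) :
    𝔼 x ∈ A, F x ≤ Real.log (Fintype.card X / #A) + c := by
  have hApos : (0 : ℝ) < #A := Nat.cast_pos.2 hA.card_pos
  have hXpos : (0 : ℝ) < Fintype.card X :=
    Nat.cast_pos.2 (hA.card_pos.trans_le (card_le_univ A))
  set l := Real.log (Fintype.card X / #A) with hl
  have h1 : ∀ x ∈ A, F x - (l + c) + 1 ≤ Real.exp (F x) * Real.exp (-(l + c)) := fun x _ => by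
    rw [← Real.exp_add]; exact Real.add_one_le_exp _
  have h2 := expect_le_expect h1
  rw [expect_add_distrib, expect_sub_distrib, expect_const hA, expect_const hA, ← expect_mul] at h2
  have h3 : (𝔼 x ∈ A, Real.exp (F x)) ≤ (Fintype.card X / #A) * Real.exp c := by
    rw [expect_eq_sum_div_card, div_mul_eq_mul_div]
    refine div_le_div_of_nonneg_right ?_ hApos.le
    rw [Fintype.expect_eq_sum_div_card, div_le_iff₀' hXpos] at hF
    exact (sum_le_sum_of_subset_of_nonneg (subset_univ A)
      fun x _ _ => (Real.exp_pos _).le).trans hF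
  have h4 : (𝔼 x ∈ A, Real.exp (F x)) * Real.exp (-(l + c)) ≤ 1 := by
    refine (mul_le_mul_of_nonneg_right h3 (Real.exp_pos _).le).trans (le_of_eq ?_)
    rw [← Real.exp_log (div_pos hXpos hApos), ← hl, ← Real.exp_add, ← Real.exp_add]
    simp
  linarith

lemma exp_expect_le {X : Type*} (A : Finset X) (hA : A.Nonempty) (f : X → ℝ) :
    Real.exp (𝔼 x ∈ A, f x) ≤ 𝔼 x ∈ A, Real.exp (f x) := by
  set c := 𝔼 x ∈ A, f x with hc
  have h1 : ∀ x ∈ A, Real.exp c * (f x - c + 1) ≤ Real.exp (f x) := fun x _ => by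
    have := mul_le_mul_of_nonneg_left (Real.add_one_le_exp (f x - c)) (Real.exp_pos c).le
    rwa [← Real.exp_add, add_sub_cancel] at this
  refine le_trans (le_of_eq ?_) (expect_le_expect h1)
  rw [← mul_expect, expect_add_distrib, expect_sub_distrib, expect_const hA, expect_const hA, ← hc]
  ring

/-- The deviation of `g (∑ t, f (x t))` from its mean. -/
noncomputable def deviation (n : ℕ) (f : Ω → ℝ) (g : ℝ → ℝ) (x : Fin n → Ω) : ℝ :=
  g (sampleSum f x) - 𝔼 x' : Fin n → Ω, g (sampleSum f x')

/-- The Gibbs inequality applied to the exponential moment bound; the weights `v` remain free for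
optimization. -/
lemma IsUncorrelatedSigns.expect_deviation_le [Nonempty Ω] (hχ : IsUncorrelatedSigns χ) {n : ℕ}
    (g : κ → ℝ → ℝ) {L : ℝ} (hg : ∀ I s, |g I (s + 1) - g I (s - 1)| ≤ 2 * L)
    (v : κ → ℝ) (hv : (∑ I, |v I|) * L ≤ 1) (A : Finset (Fin n → Ω)) (hA : A.Nonempty) :
    ∑ I, v I * 𝔼 x ∈ A, deviation n (χ I) (g I) x ≤
      Real.log (Fintype.card (Fin n → Ω) / #A) + n * (L ^ 2 * ∑ I, v I ^ 2) := by
  have h1 := hχ.expect_exp_sum_le (fun I => |v I| * L) (by rwa [← sum_mul]) n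
    (fun I s => v I * g I s) (fun I s => by
      rw [← mul_sub, abs_mul]
      nlinarith [hg I s, abs_nonneg (v I)])
  have h2 := expect_le_log_add A hA _ h1
  have h3 : (𝔼 x ∈ A, ∑ I, (v I * g I (sampleSum (χ I) x) -
      𝔼 x' : Fin n → Ω, v I * g I (sampleSum (χ I) x'))) =
      ∑ I, v I * 𝔼 x ∈ A, deviation n (χ I) (g I) x := by
    rw [expect_sum_comm]
    refine sum_congr rfl fun I _ => ?_
    rw [mul_expect]
    refine expect_congr rfl fun x _ => ?_
    rw [deviation, mul_sub, mul_expect]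
  have h4 : ∑ I, (|v I| * L) ^ 2 = L ^ 2 * ∑ I, v I ^ 2 := by
    rw [mul_sum]
    exact sum_congr rfl fun I _ => by rw [mul_pow, sq_abs]; ring
  rw [h3, h4] at h2
  exact h2

/-- The single weight `1 / √n` at `I` shows that the deviation divided by `L * √n` has exponential
moments at most `e` for both signs. Then `u ^ 4 ≤ 24 * (exp u + exp (-u))`, and `48 * e < 144`. -/
lemma IsUncorrelatedSigns.expect_deviation_pow_four_le [Nonempty Ω] (hχ : IsUncorrelatedSigns χ)
    {n : ℕ} (hn : 1 ≤ n) (I : κ) (g : ℝ → ℝ) {L : ℝ} (hL : 0 < L)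
    (hg : ∀ s, |g (s + 1) - g (s - 1)| ≤ 2 * L) :
    𝔼 x, deviation n (χ I) g x ^ 4 ≤ 144 * L ^ 4 * n ^ 2 := by
  classical
  have hn' : (1 : ℝ) ≤ n := by exact_mod_cast hn
  have hs1 : 1 ≤ Real.sqrt n := Real.one_le_sqrt.2 hn'
  have hs2 : Real.sqrt n ^ 2 = n := Real.sq_sqrt (by linarith)
  have key : ∀ ε : ℝ, |ε| = 1 → 𝔼 x, Real.exp (ε / (L * Real.sqrt n) * deviation n (χ I) g x) ≤
      Real.exp 1 := fun ε hε => by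
    have h1 := hχ.expect_exp_sum_le (fun J => if J = I then 1 / Real.sqrt n else 0) (by
      rw [sum_ite_eq' univ I]; simp; exact inv_le_one_of_one_le₀ hs1) n
      (fun J s => if J = I then ε / (L * Real.sqrt n) * g s else 0) (fun J s => by
        split_ifs
        · rw [← mul_sub, abs_mul, abs_div, hε, abs_of_pos (by positivity)]
          calc 1 / (L * Real.sqrt n) * |g (s + 1) - g (s - 1)|
              ≤ 1 / (L * Real.sqrt n) * (2 * L) :=
                mul_le_mul_of_nonneg_left (hg s) (by positivity)
            _ = 2 * (1 / Real.sqrt n) := by field_simp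
        · simp)
    have e1 : ∀ x : Fin n → Ω, ∑ J, ((if J = I then ε / (L * Real.sqrt n) *
        g (sampleSum (χ J) x) else 0) - 𝔼 x' : Fin n → Ω, (if J = I then ε / (L * Real.sqrt n) *
        g (sampleSum (χ J) x') else 0)) = ε / (L * Real.sqrt n) * deviation n (χ I) g x :=
      fun x => by
        rw [sum_eq_single I]
        · simp only [if_true]
          rw [deviation, mul_sub, mul_expect]
        · intro J _ hJ; simp [hJ]
        · simp
    have e2 : (n : ℝ) * ∑ J, (if J = I then 1 / Real.sqrt n else 0) ^ 2 = 1 := by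
      rw [sum_eq_single I]
      · simp only [if_true]
        rw [div_pow, hs2]; field_simp
      · intro J _ hJ; simp [hJ]
      · simp
    simp_rw [e1] at h1
    rwa [e2] at h1
  have hpt : ∀ u : ℝ, u ^ 4 ≤ 24 * (Real.exp u + Real.exp (-u)) := fun u => by
    have h := Real.pow_div_factorial_le_exp |u| (abs_nonneg u) 4
    rw [show ((Nat.factorial 4 : ℕ) : ℝ) = 24 by norm_num [Nat.factorial],
      show |u| ^ 4 = u ^ 4 from Even.pow_abs (by decide) u, div_le_iff₀ (by norm_num)] at h
    have : Real.exp |u| ≤ Real.exp u + Real.exp (-u) := by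
      rcases abs_choice u with e | e <;> rw [e] <;>
        linarith [Real.exp_pos u, Real.exp_pos (-u)]
    linarith
  have h5 : ∀ x, deviation n (χ I) g x ^ 4 ≤ (L ^ 4 * n ^ 2) * (24 *
      (Real.exp (1 / (L * Real.sqrt n) * deviation n (χ I) g x) +
        Real.exp (-1 / (L * Real.sqrt n) * deviation n (χ I) g x))) := fun x => by
    have h := hpt (1 / (L * Real.sqrt n) * deviation n (χ I) g x)
    have e : (L ^ 4 * n ^ 2) * (1 / (L * Real.sqrt n) * deviation n (χ I) g x) ^ 4 =
        deviation n (χ I) g x ^ 4 := by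
      rw [mul_pow, div_pow, mul_pow, show Real.sqrt n ^ 4 = (Real.sqrt n ^ 2) ^ 2 by ring, hs2]
      field_simp
    rw [← e, show -1 / (L * Real.sqrt n) * deviation n (χ I) g x =
      -(1 / (L * Real.sqrt n) * deviation n (χ I) g x) by ring]
    exact mul_le_mul_of_nonneg_left h (by positivity)
  refine (expect_le_expect fun x _ => h5 x).trans ?_
  rw [← mul_expect, ← mul_expect, expect_add_distrib]
  have h6 := key 1 (by norm_num)
  have h7 := key (-1) (by norm_num)
  have h8 := Real.exp_one_lt_d9
  have h9 : (0 : ℝ) < L ^ 4 * n ^ 2 := by positivity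
  nlinarith

/-- A level-one inequality: conditioning on a set `A` moves the means of Lipschitz functions of the
sample sums only little in the quadratic mean, up to a contribution of large deviations. -/
lemma IsUncorrelatedSigns.sum_expect_deviation_sq_le [Nonempty Ω] (hχ : IsUncorrelatedSigns χ)
    {n : ℕ} (hn : 1 ≤ n) (g : κ → ℝ → ℝ) {L : ℝ} (hL : 0 < L)
    (hg : ∀ I s, |g I (s + 1) - g I (s - 1)| ≤ 2 * L) (A : Finset (Fin n → Ω)) (hA : A.Nonempty) :
    ∑ I, (𝔼 x ∈ A, deviation n (χ I) (g I) x) ^ 2 ≤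
      4 * L ^ 2 * n * Real.log (Fintype.card (Fin n → Ω) / #A) +
      𝔼 x ∈ A, ∑ I, (Fintype.card κ : ℝ) ^ 2 / (4 * L ^ 2 * n ^ 2) *
        deviation n (χ I) (g I) x ^ 4 := by
  set k : ℝ := ((Fintype.card κ : ℕ) : ℝ) with hk
  set y : κ → ℝ := fun I => 𝔼 x ∈ A, deviation n (χ I) (g I) x with hy
  set σ : ℝ := ∑ I, y I ^ 2 with hσ
  set l := Real.log (Fintype.card (Fin n → Ω) / #A) with hl
  have hn' : (1 : ℝ) ≤ n := by exact_mod_cast hn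
  have hσ0 : 0 ≤ σ := sum_nonneg fun I _ => sq_nonneg _
  have hk0 : 0 ≤ k := Nat.cast_nonneg _
  have hsum : (∑ I, |y I|) ^ 2 ≤ k * σ := by
    have := sq_sum_le_card_mul_sum_sq (s := univ) (f := fun I => |y I|)
    simpa [sq_abs, hk, hσ] using this
  have hR : 0 ≤ 𝔼 x ∈ A, ∑ I, k ^ 2 / (4 * L ^ 2 * n ^ 2) * deviation n (χ I) (g I) x ^ 4 :=
    expect_nonneg fun x _ => sum_nonneg fun I _ => by positivity
  have hdv := fun c : ℝ => hχ.expect_deviation_le g hg (fun I => c * y I) (A := A) (hA := hA)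
  have hlin : ∀ c : ℝ, ∑ I, c * y I * (𝔼 x ∈ A, deviation n (χ I) (g I) x) = c * σ := fun c => by
    rw [hσ, mul_sum]; exact sum_congr rfl fun I _ => by simp only [hy]; ring
  have hquad : ∀ c : ℝ, ∑ I, (c * y I) ^ 2 = c ^ 2 * σ := fun c => by
    rw [hσ, mul_sum]; exact sum_congr rfl fun I _ => by ring
  have habs : ∀ c : ℝ, 0 ≤ c → ∑ I, |c * y I| = c * ∑ I, |y I| := fun c hc => by
    rw [mul_sum]; exact sum_congr rfl fun I _ => by rw [abs_mul, abs_of_nonneg hc]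
  have hs0 : 0 ≤ ∑ I, |y I| := sum_nonneg fun I _ => abs_nonneg _
  -- The best weights are `v = y / (2 * n * L ^ 2)`. By Cauchy–Schwarz this condition makes them
  -- admissible, that is `(∑ I, |v I|) * L ≤ 1`.
  by_cases hcase : k * σ ≤ (2 * n * L) ^ 2
  · have h1 : ∑ I, |y I| ≤ 2 * n * L := by
      refine abs_le_of_sq_le_sq' (hsum.trans hcase) (by positivity) |>.2
    have h2 := hdv (1 / (2 * n * L ^ 2)) (by
      rw [habs _ (by positivity), mul_assoc, div_mul_eq_mul_div, div_le_one (by positivity)]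
      nlinarith)
    rw [hlin, hquad] at h2
    have e : n * (L ^ 2 * ((1 / (2 * n * L ^ 2)) ^ 2 * σ)) = 1 / (4 * n * L ^ 2) * σ := by
      field_simp; ring
    have e2 : 1 / (2 * n * L ^ 2) * σ = 2 * (1 / (4 * n * L ^ 2) * σ) := by
      field_simp; ring
    rw [e, e2] at h2
    have h3 : 1 / (4 * n * L ^ 2) * σ ≤ l := by linarith
    rw [div_mul_eq_mul_div, one_mul, div_le_iff₀ (by positivity)] at h3
    nlinarith
  · rw [not_le] at hcase
    have hkpos : 0 < k := by
      rcases hk0.eq_or_lt with h | h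
      · rw [← h, zero_mul] at hcase; nlinarith [sq_nonneg (2 * n * L)]
      · exact h
    set r := Real.sqrt (k * σ) with hr
    have hr2 : r ^ 2 = k * σ := Real.sq_sqrt (by positivity)
    have hr1 : 2 * n * L < r := Real.lt_sqrt_of_sq_lt hcase
    have hr0 : 0 < r := lt_trans (by positivity) hr1
    have h1 : ∑ I, |y I| ≤ r := Real.le_sqrt_of_sq_le hsum
    -- Now the weights are scaled to the largest size that is surely admissible. This only yields `n
    -- / k ≤ l`, so `A` is small enough for a crude bound by AM-GM with the fourth powers.
    have h2 := hdv (1 / (L * r)) (by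
      rw [habs _ (by positivity), div_mul_eq_mul_div, div_mul_eq_mul_div,
        div_le_one (by positivity)]
      nlinarith)
    rw [hlin, hquad] at h2
    have hσr : σ = r ^ 2 / k := by rw [hr2]; field_simp
    have e : n * (L ^ 2 * ((1 / (L * r)) ^ 2 * σ)) = n / k := by
      rw [hσr]; field_simp
    have e2 : 1 / (L * r) * σ = r / L / k := by
      rw [hσr]; field_simp
    rw [e, e2] at h2
    have h3 : n / k ≤ l := by
      have h4 : 2 * n ≤ r / L := by rw [le_div_iff₀ hL]; linarith
      have h5 : 2 * n / k ≤ r / L / k := div_le_div_of_nonneg_right h4 hkpos.le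
      have : 2 * n / k = n / k + n / k := by ring
      linarith
    have h6 : ∀ I, y I ^ 2 ≤ L ^ 2 * n ^ 2 / k ^ 2 +
        𝔼 x ∈ A, k ^ 2 / (4 * L ^ 2 * n ^ 2) * deviation n (χ I) (g I) x ^ 4 := fun I => by
      have h7 : y I ^ 2 ≤ 𝔼 x ∈ A, deviation n (χ I) (g I) x ^ 2 := by
        have h8 : ∀ x ∈ A, 2 * y I * deviation n (χ I) (g I) x - y I ^ 2 ≤
            deviation n (χ I) (g I) x ^ 2 := fun x _ => by
          nlinarith [sq_nonneg (deviation n (χ I) (g I) x - y I)]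
        have h9 := expect_le_expect h8
        rw [expect_sub_distrib, expect_const hA, ← mul_expect] at h9
        have : (𝔼 x ∈ A, deviation n (χ I) (g I) x) = y I := rfl
        rw [this] at h9
        nlinarith
      refine h7.trans ?_
      have h10 : ∀ x ∈ A, deviation n (χ I) (g I) x ^ 2 ≤ L ^ 2 * n ^ 2 / k ^ 2 +
          k ^ 2 / (4 * L ^ 2 * n ^ 2) * deviation n (χ I) (g I) x ^ 4 := fun x _ => by
        set u := deviation n (χ I) (g I) x ^ 2 with hu
        have e3 : deviation n (χ I) (g I) x ^ 4 = u ^ 2 := by rw [hu]; ring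
        have e4 : L ^ 2 * n ^ 2 / k ^ 2 + k ^ 2 / (4 * L ^ 2 * n ^ 2) * u ^ 2 - u =
            (L * n / k - k / (2 * L * n) * u) ^ 2 := by
          field_simp; ring
        rw [e3]
        nlinarith [sq_nonneg (L * n / k - k / (2 * L * n) * u)]
      refine (expect_le_expect h10).trans (le_of_eq ?_)
      rw [expect_add_distrib, expect_const hA]
    have h11 := sum_le_sum fun I (_ : I ∈ (univ : Finset κ)) => h6 I
    rw [sum_add_distrib, sum_const, card_univ, nsmul_eq_mul, ← hk, ← expect_sum_comm] at h11
    have e5 : k * (L ^ 2 * n ^ 2 / k ^ 2) = L ^ 2 * n * (n / k) := by field_simp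
    rw [e5] at h11
    have h12 : L ^ 2 * n * (n / k) ≤ L ^ 2 * n * l := mul_le_mul_of_nonneg_left h3 (by positivity)
    have h13 : 0 ≤ L ^ 2 * n * (n / k) := by positivity
    linarith

end LevelOne

/-! ### The likelihood ratio of one party -/

section Likelihood

open Finset
open scoped BigOperators

set_option linter.unusedSectionVars false

variable {κ Ω : Type*} [Fintype κ] [Fintype Ω]

/-- The likelihood ratio of a sample whose entries have density `1 + ρ f`. -/
noncomputable def likelihood (ρ : ℝ) (f : Ω → ℝ) {n : ℕ} (x : Fin n → Ω) : ℝ :=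
  ∏ t, (1 + ρ * f (x t))

/-- Half the logarithmic odds of `(1 + ρ) / 2`. -/
noncomputable def logOdds (ρ : ℝ) : ℝ := (Real.log (1 + ρ) - Real.log (1 - ρ)) / 2

/-- The mean of the logarithms of `1 + ρ` and `1 - ρ`. -/
noncomputable def logMean (ρ : ℝ) : ℝ := (Real.log (1 + ρ) + Real.log (1 - ρ)) / 2

variable {ρ : ℝ}

lemma logOdds_nonneg (h0 : 0 < ρ) (h1 : ρ ≤ 1 / 2) : 0 ≤ logOdds ρ := by
  have : Real.log (1 - ρ) ≤ Real.log (1 + ρ) := Real.log_le_log (by linarith) (by linarith)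
  unfold logOdds; linarith

lemma neg_log_one_sub_le (h0 : 0 < ρ) (h1 : ρ ≤ 1 / 2) : -Real.log (1 - ρ) ≤ 2 * ρ := by
  have h2 := Real.one_sub_inv_le_log_of_pos (show 0 < 1 - ρ by linarith)
  have h3 : (1 - ρ)⁻¹ ≤ 1 + 2 * ρ := by
    rw [inv_le_iff_one_le_mul₀ (by linarith)]; nlinarith
  linarith

lemma logOdds_le (h0 : 0 < ρ) (h1 : ρ ≤ 1 / 2) : logOdds ρ ≤ 2 * ρ := by
  have h2 := Real.log_le_sub_one_of_pos (show 0 < 1 + ρ by linarith)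
  have h3 := neg_log_one_sub_le h0 h1
  unfold logOdds; linarith

lemma log_one_add_add_log_one_sub (h0 : 0 < ρ) (h1 : ρ ≤ 1 / 2) :
    Real.log (1 + ρ) + Real.log (1 - ρ) = Real.log (1 - ρ ^ 2) := by
  rw [← Real.log_mul (by linarith) (by linarith)]; congr 1; ring

lemma logMean_nonpos (h0 : 0 < ρ) (h1 : ρ ≤ 1 / 2) : logMean ρ ≤ 0 := by
  have := Real.log_nonpos (x := 1 - ρ ^ 2) (by nlinarith) (by nlinarith)
  rw [logMean, log_one_add_add_log_one_sub h0 h1]; linarith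

lemma neg_sq_le_logMean (h0 : 0 < ρ) (h1 : ρ ≤ 1 / 2) : -ρ ^ 2 ≤ logMean ρ := by
  have := neg_log_one_sub_le (ρ := ρ ^ 2) (by positivity) (by nlinarith)
  rw [logMean, log_one_add_add_log_one_sub h0 h1]; linarith

lemma one_add_mul_sign (h0 : 0 < ρ) (h1 : ρ ≤ 1 / 2) {s : ℝ} (hs : s = 1 ∨ s = -1) :
    1 + ρ * s = Real.exp (logOdds ρ * s + logMean ρ) := by
  rcases hs with rfl | rfl
  · rw [show logOdds ρ * 1 + logMean ρ = Real.log (1 + ρ) by unfold logOdds logMean; ring,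
      Real.exp_log (by linarith)]; ring
  · rw [show logOdds ρ * -1 + logMean ρ = Real.log (1 - ρ) by unfold logOdds logMean; ring,
      Real.exp_log (by linarith)]; ring

lemma likelihood_eq_exp (h0 : 0 < ρ) (h1 : ρ ≤ 1 / 2) {f : Ω → ℝ} (hf : ∀ y, f y = 1 ∨ f y = -1)
    {n : ℕ} (x : Fin n → Ω) :
    likelihood ρ f x = Real.exp (logOdds ρ * sampleSum f x + n * logMean ρ) := by
  have : ∀ t, 1 + ρ * f (x t) = Real.exp (logOdds ρ * f (x t) + logMean ρ) := fun t =>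
    one_add_mul_sign h0 h1 (hf _)
  simp_rw [likelihood, this]
  rw [← Real.exp_sum, sum_add_distrib, ← mul_sum]
  simp [sampleSum]

lemma expect_prod_apply (f : Ω → ℝ) (n : ℕ) :
    𝔼 x : Fin n → Ω, ∏ t, f (x t) = (𝔼 y, f y) ^ n := by
  have h1 := prod_univ_sum (fun _ : Fin n => (univ : Finset Ω)) (fun _ y => f y)
  rw [Fintype.piFinset_univ] at h1
  rw [Fintype.expect_eq_sum_div_card, Fintype.expect_eq_sum_div_card, ← h1]
  simp [div_pow]

lemma expect_likelihood [Nonempty Ω] {f : Ω → ℝ} (hf : 𝔼 y, f y = 0) (n : ℕ) :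
    𝔼 x : Fin n → Ω, likelihood ρ f x = 1 := by
  unfold likelihood
  rw [expect_prod_apply fun y => 1 + ρ * f y, expect_add_distrib, ← mul_expect, hf,
    Fintype.expect_const]
  simp

lemma expect_exp_mul_sampleSum_le [Nonempty Ω] {f : Ω → ℝ} (hf : ∀ y, f y = 1 ∨ f y = -1)
    (hf0 : 𝔼 y, f y = 0) (n : ℕ) (c : ℝ) :
    𝔼 x : Fin n → Ω, Real.exp (c * sampleSum f x) ≤ Real.exp (n * (c ^ 2 / 2)) := by
  have h1 : ∀ x : Fin n → Ω, Real.exp (c * sampleSum f x) = ∏ t, Real.exp (c * f (x t)) :=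
    fun x => by rw [sampleSum, mul_sum, Real.exp_sum]
  simp_rw [h1]
  rw [expect_prod_apply fun y => Real.exp (c * f y)]
  have h2 : ∀ y, Real.exp (c * f y) = Real.cosh c + Real.sinh c * f y := fun y => by
    rcases hf y with h | h <;> rw [h]
    · rw [mul_one, mul_one, Real.cosh_add_sinh]
    · rw [mul_neg_one, mul_neg_one, ← sub_eq_add_neg, Real.cosh_sub_sinh]
  simp_rw [h2]
  rw [expect_add_distrib, ← mul_expect, hf0, Fintype.expect_const, mul_zero, add_zero,
    Real.exp_nat_mul]
  exact pow_le_pow_left₀ (Real.cosh_pos c).le (Real.cosh_le_exp_half_sq c) n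

/-- Large values of the likelihood ratio carry little mass. -/
lemma expect_likelihood_sub_two_le [Nonempty Ω] {f : Ω → ℝ} (hf : ∀ y, f y = 1 ∨ f y = -1)
    (hf0 : 𝔼 y, f y = 0) {n : ℕ} (hn : 1 ≤ n) (h0 : 0 < ρ) (h1 : ρ ≤ 1 / 2)
    (hρ : ρ ^ 2 * n ≤ 1 / 16) :
    𝔼 x : Fin n → Ω, max (likelihood ρ f x - 2) 0 ≤ Real.exp (-(1 / (100 * (ρ ^ 2 * n)))) := by
  have hn' : (1 : ℝ) ≤ n := by exact_mod_cast hn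
  set a := logOdds ρ with ha
  set N : ℝ := ρ ^ 2 * n with hN
  have hNpos : 0 < N := by positivity
  -- The Chernoff exponent: it makes the moment term at most `θ / 2`, while the threshold `u > log
  -- 2` gains `θ * log 2`. The net gain exceeds `16 / 100 * θ = 1 / (100 * N)`.
  set θ : ℝ := 1 / (16 * N) with hθ
  have hθ1 : 1 ≤ θ := by rw [hθ, le_div_iff₀ (by positivity)]; linarith
  have hpt : ∀ x : Fin n → Ω, max (likelihood ρ f x - 2) 0 ≤
      Real.exp ((1 + θ) * a * sampleSum f x) * Real.exp (-(θ * Real.log 2)) := fun x => by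
    rw [← Real.exp_add]
    refine max_le ?_ (Real.exp_pos _).le
    rw [likelihood_eq_exp h0 h1 hf]
    have hb : (n : ℝ) * logMean ρ ≤ 0 :=
      mul_nonpos_of_nonneg_of_nonpos (by linarith) (logMean_nonpos h0 h1)
    set u := a * sampleSum f x with hu
    have hle : Real.exp (u + n * logMean ρ) ≤ Real.exp u := Real.exp_le_exp.2 (by linarith)
    by_cases h2 : u ≤ Real.log 2
    · have : Real.exp u ≤ 2 := by
        rw [← Real.exp_log (show (0 : ℝ) < 2 by norm_num)]; exact Real.exp_le_exp.2 h2
      linarith [Real.exp_pos ((1 + θ) * a * sampleSum f x + -(θ * Real.log 2))]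
    · have : Real.exp u ≤ Real.exp ((1 + θ) * a * sampleSum f x + -(θ * Real.log 2)) := by
        refine Real.exp_le_exp.2 ?_
        rw [mul_assoc, ← hu]
        nlinarith
      linarith
  refine (expect_le_expect fun x _ => hpt x).trans ?_
  rw [← expect_mul]
  refine (mul_le_mul_of_nonneg_right (expect_exp_mul_sampleSum_le hf hf0 n _)
    (Real.exp_pos _).le).trans ?_
  rw [← Real.exp_add, Real.exp_le_exp]
  have ha0 : 0 ≤ a := logOdds_nonneg h0 h1
  have ha1 : a ≤ 2 * ρ := logOdds_le h0 h1
  have ha2 : a ^ 2 * n ≤ 4 * N := by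
    have : a ^ 2 ≤ (2 * ρ) ^ 2 := pow_le_pow_left₀ ha0 ha1 2
    rw [hN]; nlinarith
  have h3 : n * (((1 + θ) * a) ^ 2 / 2) ≤ θ / 2 := by
    have e1 : (1 + θ) ^ 2 ≤ (2 * θ) ^ 2 := pow_le_pow_left₀ (by linarith) (by linarith) 2
    have e2 : n * (((1 + θ) * a) ^ 2 / 2) = (1 + θ) ^ 2 * (a ^ 2 * n) / 2 := by ring
    have e3 : (1 + θ) ^ 2 * (a ^ 2 * n) ≤ (2 * θ) ^ 2 * (4 * N) :=
      mul_le_mul e1 ha2 (by positivity) (by positivity)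
    have e4 : θ * N = 1 / 16 := by rw [hθ]; field_simp
    have e5 : (2 * θ) ^ 2 * (4 * N) = θ := by
      calc (2 * θ) ^ 2 * (4 * N) = 16 * θ * (θ * N) := by ring
        _ = θ := by rw [e4]; ring
    linarith
  have h4 := Real.log_two_gt_d9
  have h5 : 1 / (100 * N) = 16 / 100 * θ := by rw [hθ]; field_simp
  rw [h5]
  nlinarith

lemma abs_min_exp_sub_min_exp_le (u v : ℝ) :
    |min (Real.exp u) 2 - min (Real.exp v) 2| ≤ 2 * |u - v| := by
  wlog h : v ≤ u generalizing u v
  · rw [abs_sub_comm, abs_sub_comm u]; exact this v u (le_of_not_ge h)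
  have hm : min (Real.exp v) 2 ≤ min (Real.exp u) 2 := min_le_min_right _ (Real.exp_le_exp.2 h)
  rw [abs_of_nonneg (sub_nonneg.2 hm), abs_of_nonneg (sub_nonneg.2 h)]
  rcases le_total 2 (Real.exp v) with h2 | h2
  · rw [min_eq_right h2, min_eq_right (h2.trans (Real.exp_le_exp.2 h))]; linarith
  rw [min_eq_left h2]
  have key : ∀ w, v - w ≤ 0 → Real.exp w ≤ 2 → Real.exp w - Real.exp v ≤ 2 * (w - v) :=
    fun w hw hw2 => by
      have h3 := mul_le_mul_of_nonneg_left (Real.add_one_le_exp (v - w)) (Real.exp_pos w).le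
      rw [← Real.exp_add, add_sub_cancel] at h3
      nlinarith
  rcases le_total (Real.exp u) 2 with h4 | h4
  · rw [min_eq_left h4]; exact key u (by linarith) h4
  · rw [min_eq_right h4]
    have h5 : Real.exp (Real.log 2) = 2 := Real.exp_log (by norm_num)
    have h6 : v ≤ Real.log 2 := by rw [← Real.exp_le_exp, h5]; exact h2
    have h7 : Real.log 2 ≤ u := by rw [← Real.exp_le_exp, h5]; exact h4
    have := key (Real.log 2) (by linarith) h5.le
    rw [h5] at this
    linarith

/-- Bound on the relative entropy integrand in terms of a first-order part `y` and an error `e`;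
the lower bound on the logarithm takes care of the values near `-1`. -/
lemma sub_log_one_add_le {z y e u : ℝ} (hz : 0 < 1 + z) (hzy : z = y + e)
    (hu : -Real.log (1 + z) ≤ -u + 1 / 10) :
    z - Real.log (1 + z) ≤ 8 * y ^ 2 + 4 * u ^ 2 + 2 * |e| := by
  by_cases h : z ≤ -1 / 2
  -- Here `hu` bounds the left side by `-u - 2 / 5`, which is below `4 * u ^ 2`. In the other case
  -- the left side is at most both `2 * z ^ 2` and `|z|`; which one is used depends on whether `y`
  -- or `e` dominates.
  · nlinarith [sq_nonneg y, abs_nonneg e, sq_nonneg (4 * u + 1 / 2)]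
  rw [not_le] at h
  have h1 := Real.one_sub_inv_le_log_of_pos hz
  have h2 : z - Real.log (1 + z) ≤ z ^ 2 * (1 + z)⁻¹ := by
    have : z - (1 - (1 + z)⁻¹) = z ^ 2 * (1 + z)⁻¹ := by field_simp; ring
    linarith
  have h3 : (1 + z)⁻¹ ≤ 2 := by
    rw [inv_le_comm₀ hz (by norm_num)]; linarith
  have h4 : z - Real.log (1 + z) ≤ 2 * z ^ 2 := by nlinarith [sq_nonneg z]
  have h5 : z - Real.log (1 + z) ≤ |z| := by
    refine h2.trans ?_
    rw [← div_eq_mul_inv, div_le_iff₀ hz, ← sq_abs]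
    rcases abs_cases z with ⟨h6, h7⟩ | ⟨h6, h7⟩ <;> rw [h6] <;> nlinarith
  have h6 : |z| ≤ |y| + |e| := hzy ▸ abs_add_le y e
  rcases le_total |e| |y| with h7 | h7
  · have : z ^ 2 ≤ (2 * |y|) ^ 2 := by
      rw [← sq_abs z]; exact pow_le_pow_left₀ (abs_nonneg _) (by linarith) 2
    rw [mul_pow, sq_abs] at this
    nlinarith [sq_nonneg u, abs_nonneg e]
  · nlinarith [sq_nonneg u, sq_nonneg y]

variable {χ : κ → Ω → ℝ}

/-- The level-one inequality is used twice: for the likelihood truncated at 2, which is the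
first-order part of `z`, and for the linear function `a * s`, which by Jensen bounds `log (1 + z)`
from below when `z` is near `-1`. `G` collects the fourth moments of both and the mass above the
truncation. -/
lemma IsUncorrelatedSigns.exists_sum_sub_log_le [Nonempty Ω] (hχ : IsUncorrelatedSigns χ) {n : ℕ}
    (hn : 1 ≤ n) (hκ : Fintype.card κ ^ 3 ≤ n) (h0 : 0 < ρ) (h1 : ρ ≤ 1 / 2)
    (hρ : ρ ^ 2 * n ≤ 1 / 16)
    (hκρ : Fintype.card κ * Real.exp (-(1 / (100 * (ρ ^ 2 * n)))) ≤ 200 * (ρ ^ 2 * n)) :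
    ∃ G : (Fin n → Ω) → ℝ, 𝔼 x, G x ≤ 7712 * (ρ ^ 2 * n) ∧
      ∀ A : Finset (Fin n → Ω), A.Nonempty →
        ∑ I, ((𝔼 x ∈ A, likelihood ρ (χ I) x) - 1 -
          Real.log (𝔼 x ∈ A, likelihood ρ (χ I) x)) ≤
        768 * (ρ ^ 2 * n) * Real.log (Fintype.card (Fin n → Ω) / #A) + 𝔼 x ∈ A, G x := by
  have hn' : (1 : ℝ) ≤ n := by exact_mod_cast hn
  set a := logOdds ρ with ha
  set b : ℝ := n * logMean ρ with hb
  have ha0 : 0 ≤ a := logOdds_nonneg h0 h1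
  have ha1 : a ≤ 2 * ρ := logOdds_le h0 h1
  have hb1 : -(1 / 10) ≤ b := by
    have := mul_le_mul_of_nonneg_left (neg_sq_le_logMean h0 h1) (show (0 : ℝ) ≤ n by linarith)
    rw [hb]; nlinarith
  set L : ℝ := 4 * ρ with hL
  have hL0 : 0 < L := by positivity
  set g₁ : ℝ → ℝ := fun s => min (Real.exp (a * s + b)) 2 with hg₁
  set g₂ : ℝ → ℝ := fun s => a * s with hg₂
  have hlip₁ : ∀ s, |g₁ (s + 1) - g₁ (s - 1)| ≤ 2 * L := fun s => by
    refine (abs_min_exp_sub_min_exp_le _ _).trans ?_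
    rw [show a * (s + 1) + b - (a * (s - 1) + b) = 2 * a by ring, abs_of_nonneg (by linarith)]
    linarith
  have hlip₂ : ∀ s, |g₂ (s + 1) - g₂ (s - 1)| ≤ 2 * L := fun s => by
    simp only [hg₂]
    rw [show a * (s + 1) - (a * (s - 1)) = 2 * a by ring, abs_of_nonneg (by linarith)]
    linarith
  set excess : κ → (Fin n → Ω) → ℝ := fun I x => max (likelihood ρ (χ I) x - 2) 0 with hexcess
  have hΛ : ∀ I (x : Fin n → Ω), likelihood ρ (χ I) x = Real.exp (a * sampleSum (χ I) x + b) :=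
    fun I x => likelihood_eq_exp h0 h1 (hχ.sign I) x
  have hsplit : ∀ I (x : Fin n → Ω), likelihood ρ (χ I) x =
      g₁ (sampleSum (χ I) x) + excess I x := fun I x => by
    simp only [hg₁, hexcess, ← hΛ]
    rcases le_total (likelihood ρ (χ I) x) 2 with h | h
    · rw [min_eq_left h, max_eq_right (by linarith)]; ring
    · rw [min_eq_right h, max_eq_left (by linarith)]; ring
  set δ : κ → ℝ := fun I => 𝔼 x, excess I x with hδ
  have hexcess0 : ∀ I x, 0 ≤ excess I x := fun I x => le_max_right _ _
  have hδ0 : ∀ I, 0 ≤ δ I := fun I => expect_nonneg fun x _ => hexcess0 I x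
  have hδ1 : ∀ I, δ I ≤ Real.exp (-(1 / (100 * (ρ ^ 2 * n)))) := fun I =>
    expect_likelihood_sub_two_le (hχ.sign I) (hχ.mean I) hn h0 h1 hρ
  set c₄ : ℝ := (Fintype.card κ : ℝ) ^ 2 / (4 * L ^ 2 * n ^ 2) with hc₄
  have hc₄0 : 0 ≤ c₄ := by positivity
  refine ⟨fun x => 8 * (∑ I, c₄ * deviation n (χ I) g₁ x ^ 4) +
    4 * (∑ I, c₄ * deviation n (χ I) g₂ x ^ 4) + 2 * ∑ I, (excess I x + δ I), ?_, ?_⟩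
  · have hfour : ∀ g : ℝ → ℝ, (∀ s, |g (s + 1) - g (s - 1)| ≤ 2 * L) →
        𝔼 x : Fin n → Ω, ∑ I, c₄ * deviation n (χ I) g x ^ 4 ≤ 576 * (ρ ^ 2 * n) := fun g hg => by
      rw [expect_sum_comm]
      have e1 : ∀ I ∈ (univ : Finset κ), 𝔼 x, c₄ * deviation n (χ I) g x ^ 4 ≤
          c₄ * (144 * L ^ 4 * n ^ 2) := fun I _ => by
        rw [← mul_expect]
        exact mul_le_mul_of_nonneg_left
          (hχ.expect_deviation_pow_four_le hn I g hL0 hg) hc₄0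
      refine (sum_le_sum e1).trans ?_
      rw [sum_const, card_univ, nsmul_eq_mul]
      -- The cube of the number of candidates arises here: two factors from `c₄` and one from the
      -- sum over `I`.
      have e2 : (Fintype.card κ : ℝ) * (c₄ * (144 * L ^ 4 * n ^ 2)) =
          576 * ρ ^ 2 * (Fintype.card κ : ℝ) ^ 3 := by
        rw [hc₄, hL]; field_simp; ring
      have e3 : (Fintype.card κ : ℝ) ^ 3 ≤ n := by exact_mod_cast hκ
      rw [e2]
      have : 0 ≤ 576 * ρ ^ 2 := by positivity
      nlinarith
    have h2 := hfour g₁ hlip₁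
    have h3 := hfour g₂ hlip₂
    have h4 : 𝔼 x : Fin n → Ω, ∑ I, (excess I x + δ I) ≤ 400 * (ρ ^ 2 * n) := by
      rw [expect_sum_comm]
      have e1 : ∀ I ∈ (univ : Finset κ), 𝔼 x, (excess I x + δ I) ≤
          2 * Real.exp (-(1 / (100 * (ρ ^ 2 * n)))) := fun I _ => by
        rw [expect_add_distrib, Fintype.expect_const]
        have := hδ1 I
        simp only [hδ] at this ⊢
        linarith
      refine (sum_le_sum e1).trans ?_
      rw [sum_const, card_univ, nsmul_eq_mul]
      linarith
    rw [expect_add_distrib, expect_add_distrib, ← mul_expect, ← mul_expect, ← mul_expect]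
    linarith
  · intro A hA
    set y₁ : κ → ℝ := fun I => 𝔼 x ∈ A, deviation n (χ I) g₁ x with hy₁
    set y₂ : κ → ℝ := fun I => 𝔼 x ∈ A, deviation n (χ I) g₂ x with hy₂
    have hmeanS : ∀ I, 𝔼 x : Fin n → Ω, sampleSum (χ I) x = 0 := fun I => by
      unfold sampleSum
      rw [expect_sum_comm]
      classical
      refine sum_eq_zero fun t _ => ?_
      have := sum_mul_eval_of_update (fun _ : Fin n → Ω => (1 : ℝ)) t (fun _ _ => rfl) (χ I)
      simp only [one_mul] at this
      rw [Fintype.expect_eq_sum_div_card, this, hχ.mean]; simp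
    have hterm : ∀ I, (𝔼 x ∈ A, likelihood ρ (χ I) x) - 1 -
        Real.log (𝔼 x ∈ A, likelihood ρ (χ I) x) ≤
        8 * y₁ I ^ 2 + 4 * y₂ I ^ 2 + 2 * 𝔼 x ∈ A, (excess I x + δ I) := fun I => by
      set Λ := 𝔼 x ∈ A, likelihood ρ (χ I) x with hΛA
      have hpos : 0 < Λ := expect_pos (fun x _ => by rw [hΛ]; exact Real.exp_pos _) hA
      have hm1 : 𝔼 x : Fin n → Ω, g₁ (sampleSum (χ I) x) = 1 - δ I := by
        have e := expect_likelihood (ρ := ρ) (hχ.mean I) n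
        simp_rw [hsplit] at e
        rw [expect_add_distrib] at e
        simp only [hδ]; linarith
      have hz : Λ - 1 = y₁ I + ((𝔼 x ∈ A, excess I x) - δ I) := by
        have e1 : y₁ I = (𝔼 x ∈ A, g₁ (sampleSum (χ I) x)) - (1 - δ I) := by
          simp only [hy₁, deviation]
          rw [expect_sub_distrib, expect_const hA, hm1]
        rw [e1, hΛA]
        simp_rw [hsplit]
        rw [expect_add_distrib]; ring
      have hu : -Real.log (1 + (Λ - 1)) ≤ -y₂ I + 1 / 10 := by
        have e1 : y₂ I = a * 𝔼 x ∈ A, sampleSum (χ I) x := by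
          simp only [hy₂, deviation, hg₂]
          rw [expect_sub_distrib, expect_const hA, ← mul_expect, ← mul_expect, hmeanS]; ring
        have e2 := exp_expect_le A hA fun x => a * sampleSum (χ I) x + b
        simp_rw [← hΛ] at e2
        rw [← hΛA, expect_add_distrib, expect_const hA, ← mul_expect, ← e1] at e2
        rw [add_sub_cancel]
        have e3 := (Real.le_log_iff_exp_le hpos).2 e2
        linarith
      have hmain := sub_log_one_add_le (by linarith) hz hu
      rw [add_sub_cancel] at hmain
      have habs : |(𝔼 x ∈ A, excess I x) - δ I| ≤ 𝔼 x ∈ A, (excess I x + δ I) := by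
        rw [expect_add_distrib, expect_const hA]
        have e1 : 0 ≤ 𝔼 x ∈ A, excess I x := expect_nonneg fun x _ => hexcess0 I x
        rw [abs_le]
        constructor <;> linarith [hδ0 I]
      linarith
    refine (sum_le_sum fun I _ => hterm I).trans ?_
    have h2 := hχ.sum_expect_deviation_sq_le hn (fun _ => g₁) hL0 (fun _ => hlip₁) A hA
    have h3 := hχ.sum_expect_deviation_sq_le hn (fun _ => g₂) hL0 (fun _ => hlip₂) A hA
    rw [← hc₄] at h2 h3
    rw [sum_add_distrib, sum_add_distrib, ← mul_sum, ← mul_sum, ← mul_sum, expect_add_distrib,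
      expect_add_distrib, ← mul_expect, ← mul_expect, ← mul_expect,
      expect_sum_comm A univ fun x I => excess I x + δ I]
    have e : 4 * L ^ 2 * n = 64 * (ρ ^ 2 * n) := by rw [hL]; ring
    rw [e] at h2 h3
    simp only [hy₁, hy₂]
    linarith

end Likelihood

/-! ### Combinatorics and measurability of transcripts -/

namespace Protocol

open Finset

variable {m : ℕ} {X ι R : Type*} [MeasurableSpace X] [MeasurableSpace R] (π : Protocol m X ι R)
  (r : R) (x : Fin m → X)

lemma history_succ_of_none {t : ℕ} (h : π.speaker r (π.history r x t) = none) :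
    π.history r x (t + 1) = π.history r x t := by
  rw [history]; split
  · rfl
  · rename_i j hj; rw [h] at hj; exact absurd hj (by simp)

lemma history_succ_of_some {t : ℕ} {j : Fin m} (h : π.speaker r (π.history r x t) = some j) :
    π.history r x (t + 1) =
      π.history r x t ++ [π.message r j (x j) (π.history r x t)] := by
  rw [history]; split
  · rename_i hj; rw [h] at hj; exact absurd hj (by simp)
  · rename_i i hi; rw [h, Option.some.injEq] at hi; rw [hi]

lemma length_history_le (t : ℕ) : (π.history r x t).length ≤ t := by
  induction t with
  | zero => simp [history]
  | succ t ih =>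
    rcases h : π.speaker r (π.history r x t) with _ | j
    · rw [π.history_succ_of_none r x h]; omega
    · rw [π.history_succ_of_some r x h, List.length_append]; simpa using ih

lemma length_history_eq {t : ℕ} (ht : π.speaker r (π.history r x t) ≠ none) :
    (π.history r x t).length = t := by
  induction t with
  | zero => simp [history]
  | succ t ih =>
    rcases h : π.speaker r (π.history r x t) with _ | j
    · rw [π.history_succ_of_none r x h] at ht; exact absurd h ht
    · rw [π.history_succ_of_some r x h, List.length_append, ih (by simp [h])]; simp

/-- A running protocol has sent exactly `t` bits after `t` steps, so later histories determine
earlier ones. -/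
lemma history_eq_take (t : ℕ) : π.history r x t = (π.history r x (t + 1)).take t := by
  rcases h : π.speaker r (π.history r x t) with _ | j
  · rw [π.history_succ_of_none r x h, List.take_of_length_le (π.length_history_le r x t)]
  · have hl := π.length_history_eq r x (t := t) (by simp [h])
    rw [π.history_succ_of_some r x h, List.take_left' hl]

lemma history_eq_of_none {s t : ℕ} (hst : s ≤ t) (h : π.speaker r (π.history r x s) = none) :
    π.history r x t = π.history r x s := by
  induction t, hst using Nat.le_induction with
  | base => rfl
  | succ t _ ih => rw [π.history_succ_of_none r x (by rw [ih]; exact h), ih]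

lemma history_update [DecidableEq (Fin m)] {t : ℕ} {j : Fin m}
    (h : ∀ s < t, π.speaker r (π.history r x s) ≠ some j) (y : X) :
    π.history r (Function.update x j y) t = π.history r x t := by
  induction t with
  | zero => rfl
  | succ t ih =>
    have ih' := ih fun s hs => h s (by omega)
    rcases hi : π.speaker r (π.history r x t) with _ | i
    · rw [π.history_succ_of_none r x hi, π.history_succ_of_none r _ (by rw [ih']; exact hi), ih']
    · have hij : i ≠ j := fun e => h t (by omega) (by rw [hi, e])
      rw [π.history_succ_of_some r x hi, π.history_succ_of_some r _ (by rw [ih']; exact hi), ih',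
        Function.update_of_ne hij]

variable [Fintype X] [DecidableEq X]

/-- Given the history so far, the next bit depends only on the input of its speaker, so inputs with
the same history can be mixed coordinatewise. -/
lemma isRectangular_history [NeZero m] (t : ℕ) :
    IsRectangular fun x : Fin m → X => π.history r x t := by
  induction t with
  | zero =>
    intro h x hx
    -- Some party is needed here: with no parties the condition on the cells is vacuous, even for an
    -- `h` that is never attained.
    obtain ⟨x', hx', -⟩ := mem_image.1 (hx 0)
    exact (mem_filter.1 hx').2
  | succ t ih =>
    intro h x hx
    have hprev : ∀ x' : Fin m → X, π.history r x' (t + 1) = h → π.history r x' t = h.take t :=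
      fun x' e => by rw [π.history_eq_take r x' t, e]
    have hcell : ∀ j, ∃ x' : Fin m → X, π.history r x' (t + 1) = h ∧ x' j = x j := fun j => by
      obtain ⟨x', hx', e⟩ := mem_image.1 (hx j)
      exact ⟨x', (mem_filter.1 hx').2, e⟩
    have hxt : π.history r x t = h.take t := ih _ _ fun j => by
      obtain ⟨x', e1, e2⟩ := hcell j
      exact mem_image.2 ⟨x', mem_filter.2 ⟨mem_univ _, hprev x' e1⟩, e2⟩
    change π.history r x (t + 1) = h
    rcases hs : π.speaker r (h.take t) with _ | j
    · obtain ⟨x', e1, -⟩ := hcell 0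
      rw [π.history_succ_of_none r x (by rw [hxt]; exact hs), hxt, ← hprev x' e1,
        ← π.history_succ_of_none r x' (by rw [hprev x' e1]; exact hs), e1]
    · obtain ⟨x', e1, e2⟩ := hcell j
      have h3 := π.history_succ_of_some r x' (t := t) (j := j) (by rw [hprev x' e1]; exact hs)
      rw [e1, hprev x' e1, e2] at h3
      rw [π.history_succ_of_some r x (by rw [hxt]; exact hs), hxt, ← h3]

omit [DecidableEq X] in
lemma card_image_history_le (t : ℕ) :
    #(univ.image fun x : Fin m → X => π.history r x t) ≤ 2 ^ t := by
  induction t with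
  | zero =>
    rw [pow_zero, card_le_one]
    intro a ha b hb
    obtain ⟨_, -, rfl⟩ := mem_image.1 ha
    obtain ⟨_, -, rfl⟩ := mem_image.1 hb
    rfl
  | succ t ih =>
    let F : List Bool × Bool → List Bool := fun p =>
      match π.speaker r p.1 with
      | none => p.1
      | some _ => p.1 ++ [p.2]
    have hsub : (univ.image fun x : Fin m → X => π.history r x (t + 1)) ⊆
        ((univ.image fun x : Fin m → X => π.history r x t) ×ˢ (univ : Finset Bool)).image F := by
      intro h hh
      obtain ⟨x, -, rfl⟩ := mem_image.1 hh
      rcases hs : π.speaker r (π.history r x t) with _ | j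
      · refine mem_image.2 ⟨(π.history r x t, true), by simp, ?_⟩
        simp only [F, hs, π.history_succ_of_none r x hs]
      · refine mem_image.2 ⟨(π.history r x t, π.message r j (x j) (π.history r x t)),
          by simp, ?_⟩
        simp only [F, hs, π.history_succ_of_some r x hs]
    refine (card_le_card hsub).trans (card_image_le.trans ?_)
    rw [card_product, card_univ, Fintype.card_bool, pow_succ]
    exact Nat.mul_le_mul_right 2 ih

/-- A party who has not spoken can change her input without changing the history, and at most `t`
parties speak in `t` steps. -/
lemma card_cell_ne_univ_le (t : ℕ) :
    #(univ.filter fun j => cell (fun x : Fin m → X => π.history r x t) (π.history r x t) j ≠ univ)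
      ≤ t := by
  set S := univ.filter fun j =>
    cell (fun x : Fin m → X => π.history r x t) (π.history r x t) j ≠ univ with hS
  have hsub : S.map Function.Embedding.some ⊆
      (range t).image fun s => π.speaker r (π.history r x s) := by
    intro o ho
    obtain ⟨j, hj, rfl⟩ := mem_map.1 ho
    by_contra hcon
    refine (mem_filter.1 hj).2 (cell_eq_univ_of_update (T := fun x : Fin m → X =>
      π.history r x t) x j fun y => π.history_update r x (fun s hs e => hcon ?_) y)
    exact mem_image.2 ⟨s, mem_range.2 hs, e⟩
  have := (card_le_card hsub).trans card_image_le
  rwa [card_map, card_range] at this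

omit [Fintype X] [DecidableEq X] in
lemma speaker_eq_none_of_commComplexity_le {B : ℕ} (hB : π.commComplexity ≤ B) :
    π.speaker r (π.history r x B) = none := by
  by_contra h
  obtain ⟨j, hj⟩ := Option.ne_none_iff_exists'.1 h
  have h1 : ((π.history r x (B + 1)).length : ℕ∞) ≤ B :=
    (le_iSup_of_le r (le_iSup_of_le x (le_iSup (fun t => ((π.history r x t).length : ℕ∞))
      (B + 1)))).trans hB
  rw [π.history_succ_of_some r x hj, List.length_append, π.length_history_eq r x h] at h1
  have h2 : B + 1 ≤ B := by exact_mod_cast h1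
  omega

omit [Fintype X] [DecidableEq X] in
lemma outputs_iff {B : ℕ} (hB : π.commComplexity ≤ B) (i : ι) :
    π.Outputs r x i ↔ π.output r (π.history r x B) = i := by
  have hended := π.speaker_eq_none_of_commComplexity_le r x hB
  constructor
  · rintro ⟨t, h1, h2⟩
    rcases le_total t B with h | h
    · rw [π.history_eq_of_none r x h h1]; exact h2
    · rw [← π.history_eq_of_none r x h hended]; exact h2
  · exact fun h => ⟨B, hended, h⟩

omit [Fintype X] [DecidableEq X] in
lemma measurableSet_history_eq (t : ℕ) : ∀ h, MeasurableSet {r | π.history r x t = h} := by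
  induction t with
  | zero => intro h; exact MeasurableSet.const ([] = h)
  | succ t ih =>
    intro h
    have e : {r | π.history r x (t + 1) = h} = ⋃ h', {r | π.history r x t = h'} ∩
        (({r | π.speaker r h' = none} ∩ {_r | h' = h}) ∪ ⋃ j, {r | π.speaker r h' = some j} ∩
          {r | h' ++ [π.message r j (x j) h'] = h}) := by
      ext r
      simp only [Set.mem_ofPred_eq, Set.mem_iUnion, Set.mem_inter_iff, Set.mem_union]
      constructor
      · intro hr
        refine ⟨_, rfl, ?_⟩
        rcases hs : π.speaker r (π.history r x t) with _ | j
        · exact Or.inl ⟨rfl, by rw [← hr, π.history_succ_of_none r x hs]⟩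
        · exact Or.inr ⟨j, rfl, by rw [← hr, π.history_succ_of_some r x hs]⟩
      · rintro ⟨_, rfl, ⟨hs, hr⟩ | ⟨j, hs, hr⟩⟩
        · rw [π.history_succ_of_none r x hs, hr]
        · rw [π.history_succ_of_some r x hs, hr]
    rw [e]
    refine MeasurableSet.iUnion fun h' => (ih h').inter (((π.measurable_speaker h' none).inter
      (MeasurableSet.const _)).union (MeasurableSet.iUnion fun j =>
        (π.measurable_speaker h' (some j)).inter ?_))
    have hm : Measurable fun r => π.message r j (x j) h' :=
      (π.measurable_message j h').comp (measurable_id.prodMk measurable_const)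
    exact hm (MeasurableSet.of_discrete (s := {b | h' ++ [b] = h}))

omit [Fintype X] [DecidableEq X] in
lemma measurableSet_outputs (i : ι) : MeasurableSet {r | π.Outputs r x i} := by
  have e : {r | π.Outputs r x i} = ⋃ t, ⋃ h, {r | π.history r x t = h} ∩
      ({r | π.speaker r h = none} ∩ {r | π.output r h = i}) := by
    ext r
    simp [Outputs]
  rw [e]
  exact MeasurableSet.iUnion fun t => MeasurableSet.iUnion fun h =>
    (π.measurableSet_history_eq x t h).inter
      ((π.measurable_speaker h none).inter (π.measurable_output h i))

omit [DecidableEq X] in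
lemma measurableSet_outputs_prod [MeasurableSingletonClass X] (i : ι) :
    MeasurableSet {p : R × (Fin m → X) | π.Outputs p.1 p.2 i} := by
  have e : {p : R × (Fin m → X) | π.Outputs p.1 p.2 i} =
      ⋃ x, {r | π.Outputs r x i} ×ˢ {x} := by
    ext ⟨r, x⟩
    simp
  rw [e]
  exact MeasurableSet.iUnion fun x =>
    (π.measurableSet_outputs x i).prod (measurableSet_singleton x)

end Protocol

/-! ### Parities as uncorrelated signs, and the law of the inputs -/

section Parity

open Finset
open scoped BigOperators

instance measurableSingletonClass_intUnits : MeasurableSingletonClass ℤˣ where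
  measurableSet_singleton u := by
    refine ⟨{(u : ℤ)}, measurableSet_singleton _, ?_⟩
    ext v
    simp [Units.ext_iff]

/-- The product of the coordinates in `s`. -/
def parity {d : ℕ} (s : Finset (Fin d)) (y : Fin d → ℤˣ) : ℝ := ∏ i ∈ s, ((y i : ℤ) : ℝ)

variable {d : ℕ}

lemma parity_eq_one_or (s : Finset (Fin d)) (y : Fin d → ℤˣ) :
    parity s y = 1 ∨ parity s y = -1 := by
  have : parity s y = (((∏ i ∈ s, y i : ℤˣ) : ℤ) : ℝ) := by
    simp [parity]
  rw [this]
  rcases Int.units_eq_one_or (∏ i ∈ s, y i) with h | h <;> rw [h] <;> simp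

lemma expect_prod_signs_eq_zero (φ : Fin d → ℤˣ → ℝ) (i : Fin d) (hi : φ i 1 + φ i (-1) = 0) :
    𝔼 y : Fin d → ℤˣ, ∏ i, φ i (y i) = 0 := by
  have h := prod_univ_sum (fun _ : Fin d => (univ : Finset ℤˣ)) φ
  rw [Fintype.piFinset_univ, prod_eq_zero (mem_univ i)] at h
  · rw [Fintype.expect_eq_sum_div_card, ← h, zero_div]
  · rw [show (univ : Finset ℤˣ) = {1, -1} from rfl, sum_pair (by decide), hi]

lemma parity_eq_prod_ite (s : Finset (Fin d)) (y : Fin d → ℤˣ) :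
    parity s y = ∏ i, if i ∈ s then ((y i : ℤ) : ℝ) else 1 := by
  rw [parity, prod_ite_mem, univ_inter]

lemma isUncorrelatedSigns_parity {κ : Type*} [Fintype κ] (s : κ → Finset (Fin d))
    (hs : ∀ I, (s I).Nonempty) (hinj : Function.Injective s) :
    IsUncorrelatedSigns fun I => parity (s I) where
  sign I y := parity_eq_one_or _ y
  mean I := by
    obtain ⟨i, hi⟩ := hs I
    simp_rw [parity_eq_prod_ite]
    exact expect_prod_signs_eq_zero
      (fun i u => if i ∈ s I then ((u : ℤ) : ℝ) else 1) i (by simp [hi])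
  orth I J hIJ := by
    obtain ⟨i, hi⟩ : ∃ i, ¬(i ∈ s I ↔ i ∈ s J) := by
      by_contra! hcon
      exact hIJ (hinj (Finset.ext hcon))
    simp_rw [parity_eq_prod_ite, ← prod_mul_distrib]
    refine expect_prod_signs_eq_zero (fun i u => (if i ∈ s I then ((u : ℤ) : ℝ) else 1) *
      (if i ∈ s J then ((u : ℤ) : ℝ) else 1)) i ?_
    by_cases h1 : i ∈ s I <;> by_cases h2 : i ∈ s J <;> simp_all

lemma parityMeasure_singleton (ρ : ℝ) (I : Finset (Fin d)) (y : Fin d → ℤˣ) :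
    parityMeasure ρ I {y} = ENNReal.ofReal ((2 ^ d)⁻¹ * (1 + ρ * parity I y)) := by
  rw [parityMeasure, Measure.finsetSum_apply, sum_eq_single y]
  · simp [parity]
  · intro z _ hz
    rw [Measure.smul_apply, Measure.dirac_apply' _ (measurableSet_singleton y)]
    simp [hz]
  · simp

instance isFiniteMeasure_parityMeasure (ρ : ℝ) (I : Finset (Fin d)) :
    IsFiniteMeasure (parityMeasure ρ I) := by
  constructor
  rw [parityMeasure, Measure.finsetSum_apply]
  simp only [Measure.smul_apply, measure_univ, smul_eq_mul, mul_one]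
  exact ENNReal.sum_lt_top.2 fun y _ => ENNReal.ofReal_lt_top

lemma one_add_mul_parity_pos {ρ : ℝ} (h0 : 0 < ρ) (h1 : ρ < 1) (I : Finset (Fin d))
    (y : Fin d → ℤˣ) : 0 < 1 + ρ * parity I y := by
  rcases parity_eq_one_or I y with h | h <;> rw [h] <;> linarith

lemma pi_parityMeasure_singleton {ρ : ℝ} (h0 : 0 < ρ) (h1 : ρ < 1) (I : Finset (Fin d)) {m n : ℕ}
    (x : Fin m → Fin n → Fin d → ℤˣ) :
    (Measure.pi fun _ : Fin m => Measure.pi fun _ : Fin n => parityMeasure ρ I).real {x} =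
      (∏ j, likelihood ρ (parity I) (x j)) / Fintype.card (Fin m → Fin n → Fin d → ℤˣ) := by
  have h2 : ∀ y : Fin d → ℤˣ, 0 ≤ (2 ^ d : ℝ)⁻¹ * (1 + ρ * parity I y) := fun y =>
    mul_nonneg (by positivity) (one_add_mul_parity_pos h0 h1 I y).le
  rw [Measure.real, Measure.pi_singleton, ENNReal.toReal_prod]
  have h3 : ∀ j, (Measure.pi fun _ : Fin n => parityMeasure ρ I).real {x j} =
      ((2 ^ d : ℝ)⁻¹) ^ n * likelihood ρ (parity I) (x j) := fun j => by
    rw [Measure.real, Measure.pi_singleton, ENNReal.toReal_prod]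
    simp_rw [parityMeasure_singleton, ENNReal.toReal_ofReal (h2 _)]
    rw [prod_mul_distrib]
    simp [likelihood]
  simp only [Measure.real] at h3
  simp_rw [h3]
  rw [prod_mul_distrib, div_eq_inv_mul]
  congr 1
  simp [Fintype.card_units_int]

lemma pi_parityMeasure_real {ρ : ℝ} (h0 : 0 < ρ) (h1 : ρ < 1) (I : Finset (Fin d)) {m n : ℕ}
    (p : (Fin m → Fin n → Fin d → ℤˣ) → Prop) [DecidablePred p] :
    (Measure.pi fun _ : Fin m => Measure.pi fun _ : Fin n => parityMeasure ρ I).real {x | p x} =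
      𝔼 x, (if p x then 1 else 0) * ∏ j, likelihood ρ (parity I) (x j) := by
  have e : {x | p x} = ((univ.filter p : Finset (Fin m → Fin n → Fin d → ℤˣ)) : Set _) := by
    ext; simp
  rw [e, ← sum_measureReal_singleton, sum_filter, Fintype.expect_eq_sum_div_card, sum_div]
  refine sum_congr rfl fun x _ => ?_
  rw [pi_parityMeasure_singleton h0 h1]
  split_ifs <;> simp

end Parity

/-! ### From the entropy bound to the communication bound -/

section Identification

open Finset
open scoped BigOperators

variable {d m n : ℕ} {κ R : Type*} [Fintype κ] [MeasurableSpace R]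

/-- For fixed coins, the success probabilities of a protocol that sends `B` bits sum to little
more than `1`. -/
lemma Protocol.sum_outputs_le [NeZero m] (π : Protocol m (Fin n → Fin d → ℤˣ) κ R)
    (s : κ → Finset (Fin d)) (hs : ∀ I, (s I).Nonempty) (hinj : Function.Injective s)
    (hn : 1 ≤ n) (hκ : Fintype.card κ ^ 3 ≤ n) {ρ : ℝ} (h0 : 0 < ρ) (h1 : ρ ≤ 1 / 2)
    (hρ : ρ ^ 2 * n ≤ 1 / 16)
    (hκρ : Fintype.card κ * Real.exp (-(1 / (100 * (ρ ^ 2 * n)))) ≤ 200 * (ρ ^ 2 * n))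
    {B : ℕ} (hB : π.commComplexity ≤ B) (r : R) :
    ∑ I, (Measure.pi fun _ : Fin m => Measure.pi fun _ : Fin n => parityMeasure ρ (s I)).real
      {x | π.Outputs r x I} ≤ 1 + Fintype.card κ / 12 + 101760 * (ρ ^ 2 * n) * B := by
  classical
  have hχ := isUncorrelatedSigns_parity s hs hinj
  set T : (Fin m → Fin n → Fin d → ℤˣ) → List Bool := fun x => π.history r x B with hT
  have hrect : IsRectangular T := π.isRectangular_history r B
  set φ : κ → List Bool → ℝ := fun I h => if π.output r h = I then 1 else 0 with hφ
  set K : κ → ℝ := fun I => 𝔼 x, -Real.log (cellRatio T (likelihood ρ (parity (s I))) (T x))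
    with hK
  have hΛ : ∀ I (x : Fin n → Fin d → ℤˣ), 0 < likelihood ρ (parity (s I)) x := fun I x =>
    prod_pos fun t _ => one_add_mul_parity_pos h0 (by linarith) _ _
  have hq : ∀ I x, 0 < cellRatio T (likelihood ρ (parity (s I))) (T x) := fun I x =>
    prod_pos fun j _ => expect_pos (fun y _ => hΛ I y) (cell_nonempty x j)
  have hchange : ∀ I (ψ : List Bool → ℝ), 𝔼 x, ψ (T x) * ∏ j, likelihood ρ (parity (s I)) (x j) =
      𝔼 x, ψ (T x) * cellRatio T (likelihood ρ (parity (s I))) (T x) := fun I ψ => by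
    rw [Fintype.expect_eq_sum_div_card, Fintype.expect_eq_sum_div_card, hrect.sum_mul_prod]
  have hΛ1 : ∀ I, 𝔼 x : Fin n → Fin d → ℤˣ, likelihood ρ (parity (s I)) x = 1 := fun I =>
    expect_likelihood (hχ.mean I) n
  have hq1 : ∀ I, 𝔼 x, cellRatio T (likelihood ρ (parity (s I))) (T x) = 1 := fun I => by
    have h := hchange I fun _ => 1
    simp only [one_mul] at h
    rw [← h, expect_prod_apply fun y => likelihood ρ (parity (s I)) y, hΛ1, one_pow]
  have hterm : ∀ I, (Measure.pi fun _ : Fin m => Measure.pi fun _ : Fin n =>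
      parityMeasure ρ (s I)).real {x | π.Outputs r x I} ≤
      𝔼 x, φ I (T x) + 12 * K I + 1 / 12 := fun I => by
    have e : {x | π.Outputs r x I} = {x | π.output r (T x) = I} := by
      ext x; exact π.outputs_iff r x hB I
    rw [e, pi_parityMeasure_real h0 (by linarith), hchange I (φ I)]
    refine expect_mul_le_of_log _ _ (hq I) (hq1 I) (fun x => ?_) fun x => ?_ <;>
      simp only [hφ] <;> split_ifs <;> norm_num
  -- Under the uniform distribution exactly one output occurs for every input.
  have hφ1 : ∑ I, 𝔼 x, φ I (T x) = 1 := by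
    rw [← expect_sum_comm]
    have : ∀ x, ∑ I, φ I (T x) = 1 := fun x => by simp [hφ]
    simp_rw [this]
    exact Fintype.expect_const 1
  obtain ⟨G, hG, hone⟩ := hχ.exists_sum_sub_log_le hn hκ h0 h1 hρ hκρ
  have hN : 0 ≤ ρ ^ 2 * n := by positivity
  have hKsum : ∑ I, K I ≤ 768 * (ρ ^ 2 * n) * Real.log #(univ.image T) +
      7712 * (ρ ^ 2 * n) * B :=
    hrect.sum_expect_neg_log_le _ hΛ hΛ1 (by positivity) G hG (by positivity) hone
      fun x => π.card_cell_ne_univ_le r x B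
  have hlog : Real.log #(univ.image T) ≤ B := by
    have hpos : (0 : ℝ) < #(univ.image T) := Nat.cast_pos.2 (univ_nonempty.image T).card_pos
    have hle : (#(univ.image T) : ℝ) ≤ 2 ^ B := by exact_mod_cast π.card_image_history_le r B
    refine (Real.log_le_log hpos hle).trans ?_
    rw [Real.log_pow]
    exact mul_le_of_le_one_right (Nat.cast_nonneg B) (by linarith [Real.log_two_lt_d9])
  refine (sum_le_sum fun I _ => hterm I).trans ?_
  rw [sum_add_distrib, sum_add_distrib, hφ1, ← mul_sum, sum_const, card_univ, nsmul_eq_mul]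
  have := mul_le_mul_of_nonneg_left hlog (show 0 ≤ 768 * (ρ ^ 2 * n) by positivity)
  linarith

/-- Averaging `sum_outputs_le` over the coins gives `2k/3 ≤ 1 + k/12 + 101760 * N * B`. With `1 ≤
k/2` this leaves `k/12` on the left. -/
lemma Protocol.card_le_of_identifies [NeZero m] (π : Protocol m (Fin n → Fin d → ℤˣ) κ R)
    (s : κ → Finset (Fin d)) (hs : ∀ I, (s I).Nonempty) (hinj : Function.Injective s)
    (hn : 1 ≤ n) (hκ2 : 2 ≤ Fintype.card κ) (hκ : Fintype.card κ ^ 3 ≤ n) {ρ : ℝ} (h0 : 0 < ρ)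
    (h1 : ρ ≤ 1 / 2) (hρ : ρ ^ 2 * n ≤ 1 / 16)
    (hκρ : Fintype.card κ * Real.exp (-(1 / (100 * (ρ ^ 2 * n)))) ≤ 200 * (ρ ^ 2 * n))
    (hπ : π.Identifies (fun I => parityMeasure ρ (s I)) (1 / 3))
    {B : ℕ} (hB : π.commComplexity ≤ B) :
    (Fintype.card κ : ℝ) ≤ 1221120 * (ρ ^ 2 * n) * B := by
  have := π.isProb
  set ν : κ → Measure (Fin m → Fin n → Fin d → ℤˣ) := fun I =>
    Measure.pi fun _ : Fin m => Measure.pi fun _ : Fin n => parityMeasure ρ (s I) with hν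
  set D : ℝ := 1 + Fintype.card κ / 12 + 101760 * (ρ ^ 2 * n) * B with hD
  have hD0 : 0 ≤ D := by positivity
  have hmeas := fun I => π.measurableSet_outputs_prod I
  have hint : ∑ I, (π.coins.prod (ν I)) {p | π.Outputs p.1 p.2 I} ≤ ENNReal.ofReal D := by
    have e1 : ∀ I, (π.coins.prod (ν I)) {p | π.Outputs p.1 p.2 I} =
        ∫⁻ r, ν I {x | π.Outputs r x I} ∂π.coins := fun I => Measure.prod_apply (hmeas I)
    simp_rw [e1]
    have e2 := lintegral_finsetSum (μ := π.coins) univ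
      (f := fun I r => ν I {x | π.Outputs r x I})
      fun I _ => measurable_measure_prodMk_left (hmeas I)
    rw [← e2]
    have e3 : ∫⁻ _, ENNReal.ofReal D ∂π.coins = ENNReal.ofReal D := by simp
    rw [← e3]
    refine lintegral_mono fun r => ?_
    have h := π.sum_outputs_le s hs hinj hn hκ h0 h1 hρ hκρ hB r
    change ∑ I, ν I {x | π.Outputs r x I} ≤ ENNReal.ofReal D
    have e4 : ∀ I, ν I {x | π.Outputs r x I} =
        ENNReal.ofReal ((ν I).real {x | π.Outputs r x I}) := fun I =>
      (ofReal_measureReal (measure_ne_top _ _)).symm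
    simp_rw [e4]
    rw [← ENNReal.ofReal_sum_of_nonneg fun I _ => measureReal_nonneg]
    exact ENNReal.ofReal_le_ofReal h
  have hreal : ∑ I, (π.coins.prod (ν I)).real {p | π.Outputs p.1 p.2 I} ≤ D := by
    simp_rw [Measure.real]
    rw [← ENNReal.toReal_sum fun I _ => measure_ne_top _ _]
    exact ENNReal.toReal_le_of_le_ofReal hD0 hint
  have hlow := sum_le_sum fun I (_ : I ∈ (univ : Finset κ)) => hπ I
  rw [sum_const, card_univ, nsmul_eq_mul] at hlow
  have h2 : (2 : ℝ) ≤ Fintype.card κ := by exact_mod_cast hκ2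
  have h3 := hlow.trans hreal
  rw [hD] at h3
  linarith

lemma sq_mul_mul_log_le {ρ : ℝ} (h0 : 0 < ρ) {n : ℕ} (hn : 1 ≤ n) {k C : ℝ} (hk : 1 < k)
    (hC : 0 < C) (hρ : ρ ≤ (n : ℝ) ^ (-(1 / 2) : ℝ) * Real.log k ^ (-(1 / 2) : ℝ) / C) :
    ρ ^ 2 * n * Real.log k ≤ 1 / C ^ 2 := by
  have hn' : (0 : ℝ) < n := by exact_mod_cast hn
  have hl : 0 < Real.log k := Real.log_pos hk
  have hsq : ∀ x : ℝ, 0 < x → (x ^ (-(1 / 2) : ℝ)) ^ 2 = x⁻¹ := fun x hx => by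
    rw [← Real.rpow_natCast, ← Real.rpow_mul hx.le]
    norm_num [Real.rpow_neg_one]
  have h2 := pow_le_pow_left₀ h0.le hρ 2
  rw [div_pow, mul_pow, hsq _ hn', hsq _ hl] at h2
  calc ρ ^ 2 * n * Real.log k ≤ ((n : ℝ)⁻¹ * (Real.log k)⁻¹ / C ^ 2) * n * Real.log k := by gcongr
    _ = 1 / C ^ 2 := by field_simp

/-- The communication bound without logarithmic loss, for an injective family of nonempty index
sets. -/
lemma Protocol.card_le_of_identifies_of_le [NeZero m] (π : Protocol m (Fin n → Fin d → ℤˣ) κ R)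
    (s : κ → Finset (Fin d)) (hs : ∀ I, (s I).Nonempty) (hinj : Function.Injective s)
    (hn : 1 ≤ n) (hκ2 : 2 ≤ Fintype.card κ) (hκ : Fintype.card κ ^ 6 ≤ n) {ρ : ℝ} (h0 : 0 < ρ)
    (hρ : ρ ≤ (n : ℝ) ^ (-(1 / 2) : ℝ) * Real.log (Fintype.card κ) ^ (-(1 / 2) : ℝ) / 10 ^ 7)
    (hπ : π.Identifies (fun I => parityMeasure ρ (s I)) (1 / 3)) :
    ρ ^ 2 * n ≤ 1 / 10 ^ 13 ∧
      ∀ B : ℕ, π.commComplexity ≤ B → (Fintype.card κ : ℝ) ≤ 1221120 * (ρ ^ 2 * n) * B := by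
  have hk2 : (2 : ℝ) ≤ Fintype.card κ := by exact_mod_cast hκ2
  have hn' : (1 : ℝ) ≤ n := by exact_mod_cast hn
  have hN : 0 < ρ ^ 2 * n := by positivity
  have h2 := sq_mul_mul_log_le h0 hn (by linarith) (by norm_num) hρ
  have hlog : 1 / 2 ≤ Real.log (Fintype.card κ) :=
    le_trans (by linarith [Real.log_two_gt_d9]) (Real.log_le_log (by norm_num) hk2)
  have hsmall : ρ ^ 2 * n ≤ 1 / 10 ^ 13 := by
    norm_num at h2 ⊢
    nlinarith
  refine ⟨hsmall, fun B hB => π.card_le_of_identifies s hs hinj hn hκ2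
    ((Nat.pow_le_pow_right (by omega) (by norm_num)).trans hκ) h0 ?_ ?_ ?_ hπ hB⟩
  · have : ρ ^ 2 ≤ 1 / 10 ^ 13 := le_trans (by nlinarith [sq_nonneg ρ]) hsmall
    norm_num at this
    nlinarith
  · exact hsmall.trans (by norm_num)
  · set N := ρ ^ 2 * n with hNdef
    -- The logarithm in the bound on `ρ` serves here: `N * log k` is so small that a union over all
    -- candidates costs only half of the exponent of the truncated mass.
    have h3 : (Fintype.card κ : ℝ) ≤ Real.exp (1 / (200 * N)) := by
      rw [← Real.log_le_iff_le_exp (by linarith), le_div_iff₀ (by positivity)]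
      norm_num at h2
      nlinarith
    have h4 : Real.exp (1 / (200 * N)) * Real.exp (-(1 / (100 * N))) =
        (Real.exp (1 / (200 * N)))⁻¹ := by
      rw [← Real.exp_add, ← Real.exp_neg]
      congr 1
      field_simp
      norm_num
    calc (Fintype.card κ : ℝ) * Real.exp (-(1 / (100 * N)))
        ≤ Real.exp (1 / (200 * N)) * Real.exp (-(1 / (100 * N))) :=
          mul_le_mul_of_nonneg_right h3 (Real.exp_pos _).le
      _ = (Real.exp (1 / (200 * N)))⁻¹ := h4
      _ ≤ 200 * N := by
          rw [inv_le_comm₀ (Real.exp_pos _) (by positivity), ← one_div]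
          linarith [Real.add_one_le_exp (1 / (200 * N))]

omit [Fintype κ] in
/-- A bound linear in the number of bits implies the bound with a logarithm in the denominator. -/
lemma Protocol.ofReal_div_le_commComplexity {X : Type*} [MeasurableSpace X]
    (π : Protocol m X κ R) {a l : ℝ} {N : ℝ} (hN : 0 < N) (hl : 1 ≤ l)
    (h : ∀ B : ℕ, π.commComplexity ≤ B → a ≤ 10 ^ 7 * N * B) :
    ENNReal.ofReal (a / (10 ^ 7 * N * l)) ≤ (π.commComplexity : ℝ≥0∞) := by
  induction hB : π.commComplexity using ENat.recTopCoe with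
  | top => simp
  | coe B =>
    have h1 := h B hB.le
    rw [ENat.toENNReal_coe, ← ENNReal.ofReal_natCast]
    refine ENNReal.ofReal_le_ofReal ?_
    rw [div_le_iff₀ (by positivity)]
    refine h1.trans ?_
    have : 0 ≤ 10 ^ 7 * N * B := by positivity
    nlinarith

end Identification
theorem theorem3 :
    ∃ C : ℝ, 0 < C ∧
      -- general families of index sets
      (∀ (d : ℕ) (U : Finset (Finset (Fin d))), (∀ I ∈ U, I.Nonempty) → 2 ≤ U.card →
        ∀ m n : ℕ, 1 ≤ m → 1 ≤ n → U.card ^ 6 ≤ n →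
        ∀ ρ : ℝ, 0 < ρ → ρ < 1 →
        ρ ≤ (n : ℝ) ^ (-(1 / 2) : ℝ) * Real.log (U.card : ℝ) ^ (-(1 / 2) : ℝ) / C →
        ∀ (R : Type*) [MeasurableSpace R]
          (π : Protocol m (Fin n → (Fin d → ℤˣ)) {I : Finset (Fin d) // I ∈ U} R),
          π.Identifies (fun I => parityMeasure ρ I.1) (1 / 3) →
          ENNReal.ofReal
              ((U.card : ℝ) / (C * ρ ^ 2 * n * Real.log ((U.card : ℝ) ^ 2 / (n * ρ ^ 2))))
            ≤ (π.commComplexity : ℝ≥0∞)) ∧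
      -- pairwise correlations
      (∀ d : ℕ, 3 ≤ d →
        ∀ m n : ℕ, 1 ≤ m → 1 ≤ n → d.choose 2 ^ 6 ≤ n →
        ∀ ρ : ℝ, 0 < ρ → ρ < 1 →
        ρ ≤ (n : ℝ) ^ (-(1 / 2) : ℝ) * Real.log (d.choose 2 : ℝ) ^ (-(1 / 2) : ℝ) / C →
        ∀ (R : Type*) [MeasurableSpace R]
          (π : Protocol m (Fin n → (Fin d → ℤˣ)) {I : Finset (Fin d) // I.card = 2} R),
          π.Identifies (fun I => parityMeasure ρ I.1) (1 / 3) →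
          ENNReal.ofReal
              ((d : ℝ) ^ 2 / (C * ρ ^ 2 * n * Real.log ((d : ℝ) / (n * ρ ^ 2))))
            ≤ (π.commComplexity : ℝ≥0∞)) := by
  have hlog : ∀ {a N : ℝ}, 3 ≤ a → 0 < N → N ≤ 1 / 10 ^ 13 → 1 ≤ Real.log (a / N) := by
    intro a N ha hN hN1
    rw [Real.le_log_iff_exp_le (by positivity), le_div_iff₀ hN]
    have := Real.exp_one_lt_d9
    norm_num at hN1
    nlinarith
  refine ⟨10 ^ 7, by norm_num, ?_, ?_⟩
  · intro d U hU hU2 m n hm hn hUn ρ h0 _ hρ R _ π hπ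
    have : NeZero m := ⟨by omega⟩
    have hcard : Fintype.card {I : Finset (Fin d) // I ∈ U} = U.card := Fintype.card_coe U
    obtain ⟨hN1, hB⟩ := π.card_le_of_identifies_of_le (fun I => I.1) (fun I => hU _ I.2)
      Subtype.val_injective hn (by rwa [hcard]) (by rwa [hcard]) h0 (by rwa [hcard]) hπ
    rw [hcard] at hB
    have hn' : (0 : ℝ) < n := by exact_mod_cast hn
    have hN : 0 < ρ ^ 2 * n := by positivity
    have hk : (2 : ℝ) ≤ U.card := by exact_mod_cast hU2
    rw [show (10 : ℝ) ^ 7 * ρ ^ 2 * n = 10 ^ 7 * (ρ ^ 2 * n) by ring, mul_comm (n : ℝ) (ρ ^ 2)]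
    refine π.ofReal_div_le_commComplexity hN (hlog (by nlinarith) hN hN1) fun B h => ?_
    have h2 : 0 ≤ ρ ^ 2 * n * B := by positivity
    linarith [hB B h]
  · intro d hd m n hm hn hdn ρ h0 _ hρ R _ π hπ
    have : NeZero m := ⟨by omega⟩
    have hcard : Fintype.card {I : Finset (Fin d) // I.card = 2} = d.choose 2 := by simp
    have hd' : (3 : ℝ) ≤ d := by exact_mod_cast hd
    have hch : ((d.choose 2 : ℕ) : ℝ) = d * (d - 1) / 2 := Nat.cast_choose_two ℝ d
    have hk : 2 ≤ d.choose 2 := by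
      have : (2 : ℝ) ≤ (d.choose 2 : ℕ) := by rw [hch]; nlinarith
      exact_mod_cast this
    obtain ⟨hN1, hB⟩ := π.card_le_of_identifies_of_le (fun I => I.1)
      (fun I => Finset.card_pos.1 (by rw [I.2]; norm_num))
      Subtype.val_injective hn (by rwa [hcard]) (by rwa [hcard]) h0 (by rwa [hcard]) hπ
    rw [hcard, hch] at hB
    have hn' : (0 : ℝ) < n := by exact_mod_cast hn
    have hN : 0 < ρ ^ 2 * n := by positivity
    rw [show (10 : ℝ) ^ 7 * ρ ^ 2 * n = 10 ^ 7 * (ρ ^ 2 * n) by ring, mul_comm (n : ℝ) (ρ ^ 2)]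
    refine π.ofReal_div_le_commComplexity hN (hlog hd' hN hN1) fun B h => ?_
    have h2 : 0 ≤ ρ ^ 2 * n * B := by positivity
    -- Equality holds at `d = 3`. The factor 3 fits into the constant, as `3 * 1221120 ≤ 10 ^ 7`.
    have h3 : (d : ℝ) ^ 2 ≤ 3 * (d * (d - 1) / 2) := by nlinarith
    linarith [hB B h]
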